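/- Let $\mathbb{T}^2=(\mathbb{C}^*)^2$. A *double Segre surface* is a surface $X\subset\mathbb{P}^8$ together with a biregular isomorphism $\varphi\colon\mathbb{P}^1\times\mathbb{P}^1\to X$ whose components form a basis of the forms of bidegree $(2,2)$. A *Veronese surface* is a surface $X\subset\mathbb{P}^5$ together with a biregular isomorphism $\varphi\colon\mathbb{P}^2\to X$ whose components form a basis of the forms of degree $2$. A *toric parametrization* of $X\subset\mathbb{P}^n$ is an injective map $p\colon\mathbb{T}^2\to X$ with Zariski dense image which, up to a projective equivalence of $\mathbb{P}^n$, is a monomial parametrization $t\mapsto(t^{e_0}:\dots:t^{e_n})$ with $e_i\in\mathbb{Z}^2$; its *lattice polygon* is the convex hull of $e_0,\dots,e_n$ in $\mathbb{R}^2$. An antiholomorphic involution $\sigma\colon X\to X$ *acts as* the unimodular involution $M\in\operatorname{GL}(2,\mathbb{Z})$ of a lattice polygon $\Lambda$ if, for some toric parametrization $p$ of $X$, there are $\tau\colon\mathbb{T}^2\to\mathbb{T}^2$ and an integer matrix $N$ such that $\sigma\circ p=p\circ\tau$ and $\tau(t)^v=\overline{t^{Nv}}$ for all $v\in\mathbb{Z}^2$,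 $t\in\mathbb{T}^2$ (so $\tau$ is compatible with the group structure of $\mathbb{T}^2$; in particular $\tau(1,1)=(1,1)$), and there are $A\in\operatorname{GL}(2,\mathbb{Z})$ and $c\in\mathbb{Z}^2$ such that $x\mapsto Ax+c$ maps the lattice polygon of $p$ onto $\Lambda$ and $AN=MA$. Two self-maps $\sigma,\sigma'$ of $X$ are *inner automorphic via* $\operatorname{Aut}(Z)$, where $\varphi\colon Z\to X$ is the isomorphism above, if $\gamma^{-1}\circ\sigma\circ\gamma=\sigma'$ for some $\gamma=\varphi\circ\alpha\circ\varphi^{-1}$ with $\alpha$ a complex biregular automorphism of $Z$. (a) Let $X$ be a double Segre surface. Any two antiholomorphic involutions of $X$, each of which acts on the square with vertices $(\pm1,\pm1)$ as one of the unimodular involutions $(x,y)\mapsto(x,y)$, $(x,y)\mapsto(-x,y)$, $(x,y)\mapsto(-x,-y)$, are inner automorphic via $\operatorname{Aut}(\mathbb{P}^1\times\mathbb{P}^1)$. Moreover each of them is inner automorphic to the involution of $X$ that corresponds under $\varphi$ to $(s:t;u:w)\mapsto(\overline{s}:\overline{t};\overline{u}:\overline{w})$. (b) Let $X$ be a Veronese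 surface. Any two antiholomorphic involutions of $X$, each of which acts on the triangle with vertices $(-1,1),(1,-1),(-1,-1)$ as one of the unimodular involutions $(x,y)\mapsto(x,y)$, $(x,y)\mapsto(y,x)$, are inner automorphic via $\operatorname{Aut}(\mathbb{P}^2)$. Moreover each of them is inner automorphic to the involution of $X$ that corresponds under $\varphi$ to $(s:t:u)\mapsto(\overline{s}:\overline{t}:\overline{u})$. -/

import Mathlib

noncomputable section

namespace RealToric

/-- Complex projective `n`-space. -/
abbrev CP (n : ℕ) := Projectivization ℂ (Fin (n + 1) → ℂ)

/-! ### Regular maps and automorphism groups -/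

/-- A map `ℙⁿ → ℙᵐ` is regular if near each point (in the Zariski topology) it is given by
homogeneous polynomials of one common degree that do not vanish simultaneously at the point. -/
def IsRegularMap {n m : ℕ} (f : CP n → CP m) : Prop :=
  ∀ v : Fin (n + 1) → ℂ, v ≠ 0 →
    ∃ (d : ℕ) (F : Fin (m + 1) → MvPolynomial (Fin (n + 1)) ℂ),
      (∀ i, (F i).IsHomogeneous d) ∧
      (fun i => MvPolynomial.eval v (F i)) ≠ 0 ∧
      ∀ (w : Fin (n + 1) → ℂ) (hw : w ≠ 0) (h : (fun i => MvPolynomial.eval w (F i)) ≠ 0),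
        f (Projectivization.mk ℂ w hw) = Projectivization.mk ℂ _ h

/-- The bigrading on `ℂ[s,t;u,w]`: `s, t` have bidegree `(1,0)`, `u, w` have bidegree `(0,1)`. -/
def biWeight : Fin 2 ⊕ Fin 2 → ℕ × ℕ := Sum.elim (fun _ => (1, 0)) (fun _ => (0, 1))

/-- A map `ℙ¹ × ℙ¹ → ℙᵐ` is regular if near each point (in the Zariski topology) it is given by
bihomogeneous polynomials of one common bidegree that do not vanish simultaneously there. -/
def IsBiregularlyDefined {m : ℕ} (f : CP 1 × CP 1 → CP m) : Prop :=
  ∀ v w : Fin 2 → ℂ, v ≠ 0 → w ≠ 0 →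
    ∃ (d : ℕ × ℕ) (F : Fin (m + 1) → MvPolynomial (Fin 2 ⊕ Fin 2) ℂ),
      (∀ i, (F i).IsWeightedHomogeneous biWeight d) ∧
      (fun i => MvPolynomial.eval (Sum.elim v w) (F i)) ≠ 0 ∧
      ∀ (v' w' : Fin 2 → ℂ) (hv : v' ≠ 0) (hw : w' ≠ 0)
        (h : (fun i => MvPolynomial.eval (Sum.elim v' w') (F i)) ≠ 0),
        f (Projectivization.mk ℂ v' hv, Projectivization.mk ℂ w' hw) =
          Projectivization.mk ℂ _ h

/-- `Aut(ℙ²)`: the biregular automorphisms of the complex projective plane. -/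
def AutP2 : Set (Equiv.Perm (CP 2)) :=
  {α | IsRegularMap α ∧ IsRegularMap α.symm}

/-- A map of `ℙ¹ × ℙ¹` to itself is regular if both of its components are. -/
def IsRegularSelfMap (f : CP 1 × CP 1 → CP 1 × CP 1) : Prop :=
  IsBiregularlyDefined (fun x => (f x).1) ∧ IsBiregularlyDefined (fun x => (f x).2)

/-- `Aut(ℙ¹ × ℙ¹)`: the biregular automorphisms of the complex surface `ℙ¹ × ℙ¹`. -/
def AutP1P1 : Set (Equiv.Perm (CP 1 × CP 1)) :=
  {α | IsRegularSelfMap α ∧ IsRegularSelfMap α.symm}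

/-! ### Double Segre surfaces and Veronese surfaces -/

/-- `φ` is a bijection from `ℙ¹ × ℙ¹` onto `X ⊆ ℙ⁸` whose components form a basis of the vector
space of forms of bidegree `(2,2)`; thus `X` is a double Segre surface, with
parametrization `φ`. -/
def IsDoubleSegre {X : Set (CP 8)} (φ : CP 1 × CP 1 ≃ X) : Prop :=
  ∃ F : Fin 9 → MvPolynomial (Fin 2 ⊕ Fin 2) ℂ,
    LinearIndependent ℂ F ∧
    Submodule.span ℂ (Set.range F) =
      MvPolynomial.weightedHomogeneousSubmodule ℂ biWeight (2, 2) ∧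
    ∀ (v w : Fin 2 → ℂ) (hv : v ≠ 0) (hw : w ≠ 0),
      ∃ h : (fun i => MvPolynomial.eval (Sum.elim v w) (F i)) ≠ 0,
        (φ (Projectivization.mk ℂ v hv, Projectivization.mk ℂ w hw) : CP 8) =
          Projectivization.mk ℂ _ h

/-- `φ` is a bijection from `ℙ²` onto `X ⊆ ℙ⁵` whose components form a basis of the vector space
of forms of degree `2`; thus `X` is a Veronese surface, with parametrization `φ`. -/
def IsVeronese {X : Set (CP 5)} (φ : CP 2 ≃ X) : Prop :=
  ∃ F : Fin 6 → MvPolynomial (Fin 3) ℂ,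
    LinearIndependent ℂ F ∧
    Submodule.span ℂ (Set.range F) = MvPolynomial.homogeneousSubmodule (Fin 3) ℂ 2 ∧
    ∀ (v : Fin 3 → ℂ) (hv : v ≠ 0),
      ∃ h : (fun i => MvPolynomial.eval v (F i)) ≠ 0,
        (φ (Projectivization.mk ℂ v hv) : CP 5) = Projectivization.mk ℂ _ h

/-! ### Antiholomorphic involutions -/

/-- A self-map of `X ⊆ ℙⁿ` is antiholomorphic if locally (in the classical topology) it is given
in homogeneous coordinates by complex conjugates of holomorphic functions. -/
def IsAntiholomorphic {n : ℕ} {X : Set (CP n)} (σ : X → X) : Prop :=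
  ∀ (v : Fin (n + 1) → ℂ) (hv : v ≠ 0), Projectivization.mk ℂ v hv ∈ X →
    ∃ (U : Set (Fin (n + 1) → ℂ)) (F : (Fin (n + 1) → ℂ) → (Fin (n + 1) → ℂ)),
      IsOpen U ∧ v ∈ U ∧ DifferentiableOn ℂ F U ∧
      ∀ (w : Fin (n + 1) → ℂ) (hw : w ≠ 0) (hX : Projectivization.mk ℂ w hw ∈ X), w ∈ U →
        ∃ h : (fun i => starRingEnd ℂ (F w i)) ≠ 0,
          (σ ⟨Projectivization.mk ℂ w hw, hX⟩ : CP n) = Projectivization.mk ℂ _ h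

/-- A real structure, that is, an antiholomorphic involution. -/
def IsAntiholomorphicInvolution {n : ℕ} {X : Set (CP n)} (σ : X → X) : Prop :=
  Function.Involutive σ ∧ IsAntiholomorphic σ

/-- Coordinatewise complex conjugation of vectors. -/
def conjVec (n : ℕ) : (Fin n → ℂ) →ₛₗ[starRingEnd ℂ] (Fin n → ℂ) where
  toFun v i := starRingEnd ℂ (v i)
  map_add' _ _ := by ext i; simp
  map_smul' _ _ := by ext i; simp

theorem conjVec_injective (n : ℕ) : Function.Injective (conjVec n) := fun _ _ h =>
  funext fun i => (starRingEnd ℂ).injective (congrFun h i)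

/-- The real structure `(x₀ : … : xₙ) ↦ (x̄₀ : … : x̄ₙ)` of `ℙⁿ`. -/
def conjP (n : ℕ) : CP n → CP n :=
  Projectivization.map (conjVec (n + 1)) (conjVec_injective (n + 1))

/-- Let `φ` identify `Z` with `X` and let `A` be a group of automorphisms of `Z`. The self-maps
`σ` and `σ'` of `X` are inner automorphic via `A` if `γ⁻¹ ∘ σ ∘ γ = σ'` for the automorphism
`γ = φ ∘ α ∘ φ⁻¹` of `X` corresponding to some `α ∈ A`. -/
def InnerAutomorphicVia {Z X : Type*} (φ : Z ≃ X) (A : Set (Equiv.Perm Z)) (σ σ' : X → X) :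
    Prop :=
  ∃ α ∈ A, (φ.permCongr α).symm ∘ σ ∘ φ.permCongr α = σ'

/-! ### Toric structures and lattice types -/

/-- The algebraic torus `𝕋² = (ℂ^*)²`. -/
abbrev Torus := Fin 2 → ℂˣ

/-- The Laurent monomial `t₀ ^ v₀ * t₁ ^ v₁`. -/
def character (v : Fin 2 → ℤ) (t : Torus) : ℂ := ((∏ j, t j ^ v j : ℂˣ) : ℂ)

/-- `p : 𝕋² → X` is, up to the projective equivalence `g`, the monomial parametrization with
exponents `e`, it is injective, and its image is Zariski dense in `X`. -/
structure IsToricParametrization {n : ℕ} {X : Set (CP n)} (e : Fin (n + 1) → Fin 2 → ℤ)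
    (g : GL (Fin (n + 1)) ℂ) (p : Torus → X) : Prop where
  monomial : ∀ t : Torus,
    ∃ h : (g : Matrix (Fin (n + 1)) (Fin (n + 1)) ℂ).mulVec (fun i => character (e i) t) ≠ 0,
      (p t : CP n) = Projectivization.mk ℂ _ h
  injective : Function.Injective p
  dense : ∀ (d : ℕ) (f : MvPolynomial (Fin (n + 1)) ℂ), f.IsHomogeneous d →
    (∀ t, MvPolynomial.eval (p t : CP n).rep f = 0) →
      ∀ x ∈ X, MvPolynomial.eval (Projectivization.rep x) f = 0

/-- The lattice polygon: the convex hull of the exponents. -/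
def latticePolygon {n : ℕ} (e : Fin (n + 1) → Fin 2 → ℤ) : Set (Fin 2 → ℝ) :=
  convexHull ℝ (Set.range fun i j => (e i j : ℝ))

/-- The antiholomorphic map `τ` of the torus induces the linear map `N` of the lattice `ℤ²` of
characters: pulling back the character `v` along `τ` gives the complex conjugate of the
character `N v`. (This makes `τ` compatible with the group structure of the torus; in
particular `τ` fixes the unit.) -/
def Induces (τ : Torus → Torus) (N : Matrix (Fin 2) (Fin 2) ℤ) : Prop :=
  ∀ (v : Fin 2 → ℤ) (t : Torus), character v (τ t) = starRingEnd ℂ (character (N.mulVec v) t)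

/-- There is a unimodular isomorphism (a translation by a lattice vector composed with an element
of `GL(2,ℤ)`) between the polygons `P` and `Q` which is compatible with the linear maps `N` and
`M` of the lattice. -/
def LatticeEquivalent (P : Set (Fin 2 → ℝ)) (N : Matrix (Fin 2) (Fin 2) ℤ)
    (Q : Set (Fin 2 → ℝ)) (M : Matrix (Fin 2) (Fin 2) ℤ) : Prop :=
  ∃ (A : GL (Fin 2) ℤ) (c : Fin 2 → ℤ),
    (fun x : Fin 2 → ℝ =>
      ((A : Matrix (Fin 2) (Fin 2) ℤ).map (Int.cast : ℤ → ℝ)).mulVec x +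
        fun j => (c j : ℝ)) '' P = Q ∧
    (A : Matrix (Fin 2) (Fin 2) ℤ) * N = M * (A : Matrix (Fin 2) (Fin 2) ℤ)

/-- The self-map `σ` of `X` acts as the unimodular involution `M` of the lattice polygon `Q`: for
some toric parametrization of `X`, the map `σ` restricts to a map of the torus, and the lattice
polygon together with the induced map of the lattice is equivalent to `Q` together with `M`. -/
def ActsAs {n : ℕ} {X : Set (CP n)} (σ : X → X) (Q : Set (Fin 2 → ℝ))
    (M : Matrix (Fin 2) (Fin 2) ℤ) : Prop :=
  ∃ (e : Fin (n + 1) → Fin 2 → ℤ) (g : GL (Fin (n + 1)) ℂ) (p : Torus → X)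
    (τ : Torus → Torus) (N : Matrix (Fin 2) (Fin 2) ℤ),
    IsToricParametrization e g p ∧ (∀ t, σ (p t) = p (τ t)) ∧ Induces τ N ∧
      LatticeEquivalent (latticePolygon e) N Q M

/-- The square with vertices `(±1, ±1)`. -/
def squarePolygon : Set (Fin 2 → ℝ) :=
  convexHull ℝ {![-1, 1], ![1, 1], ![1, -1], ![-1, -1]}

/-- The triangle with vertices `(-1, 1)`, `(1, -1)`, `(-1, -1)`. -/
def trianglePolygon : Set (Fin 2 → ℝ) :=
  convexHull ℝ {![-1, 1], ![1, -1], ![-1, -1]}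

/-- The antiholomorphic involutions of `X` that act on the square with vertices `(±1, ±1)` as the
identity, as the reflection `(x, y) ↦ (-x, y)` or as the rotation `(x, y) ↦ (-x, -y)`. -/
def squareInvolutions (X : Set (CP 8)) : Set (X → X) :=
  {σ | IsAntiholomorphicInvolution σ ∧
    (ActsAs σ squarePolygon !![1, 0; 0, 1] ∨ ActsAs σ squarePolygon !![-1, 0; 0, 1] ∨
      ActsAs σ squarePolygon !![-1, 0; 0, -1])}

/-- The antiholomorphic involutions of `X` that act on the triangle with vertices `(-1, 1)`,
`(1, -1)`, `(-1, -1)` as the identity or as the reflection `(x, y) ↦ (y, x)`. -/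
def triangleInvolutions (X : Set (CP 5)) : Set (X → X) :=
  {σ | IsAntiholomorphicInvolution σ ∧
    (ActsAs σ trianglePolygon !![1, 0; 0, 1] ∨ ActsAs σ trianglePolygon !![0, 1; 1, 0])}

end RealToric

end

/-!
Both surfaces are closed toric varieties embedded by all lattice points of their polygons: the
double Segre surface by the nine points of the square, the Veronese surface by the six points of
the triangle. A toric parametrization whose polygon is equivalent to the given one must therefore
use each lattice point exactly once. So, after a linear change of coordinates of the ambient
space, an antiholomorphic involution acting as `M` is complex conjugation followed by the
permutation that `M` induces on the lattice points; both sides are continuous, hence it is enough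
to compare them on the dense torus. The permutation comes from an involutive permutation `s` of
the homogeneous coordinates of `ℙ²` or of the factors `ℙ¹`, and `y ↦ conj (y ∘ s)` is conjugate to
`y ↦ conj y` by a linear change of these coordinates. Hence every such involution is carried to
the standard one by a parametrization which differs from `φ` by a projective equivalence, and two
such parametrizations differ by an automorphism of `ℙ¹ × ℙ¹` or `ℙ²`.
-/

noncomputable section

namespace RealToric

open Filter Topology MvPolynomial Projectivization

/-! ### Projective transformations -/

/-- The projective space with homogeneous coordinates indexed by `I`, so that `CP n` is
`CoordP (Fin (n + 1))`. -/
abbrev CoordP (I : Type*) := Projectivization ℂ (I → ℂ)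

section Projective

variable {I J K : Type*}

theorem mk_eq_mk_of_mul_eq_mul {u w : I → ℂ} (hu : u ≠ 0) (hw : w ≠ 0)
    (h : ∀ i j, u i * w j = u j * w i) : mk ℂ u hu = mk ℂ w hw := by
  obtain ⟨j, hj⟩ := Function.ne_iff.mp hw
  rw [mk_eq_mk_iff']
  refine ⟨u j / w j, funext fun i => ?_⟩
  rw [Pi.smul_apply, smul_eq_mul, div_mul_eq_mul_div, ← h i j, mul_div_cancel_right₀ _ hj]

theorem exists_mk_eq (x : CoordP I) : ∃ (v : I → ℂ) (hv : v ≠ 0), mk ℂ v hv = x :=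
  ⟨x.rep, x.rep_nonzero, x.mk_rep⟩

/-- The projective transformation given by a linear isomorphism. -/
def projMap (T : (I → ℂ) ≃ₗ[ℂ] (J → ℂ)) : CoordP I → CoordP J :=
  Projectivization.map T.toLinearMap T.injective

theorem projMap_mk (T : (I → ℂ) ≃ₗ[ℂ] (J → ℂ)) (v : I → ℂ) (hv : v ≠ 0) :
    projMap T (mk ℂ v hv) = mk ℂ (T v) (T.map_ne_zero_iff.mpr hv) := rfl

theorem projMap_trans (T : (I → ℂ) ≃ₗ[ℂ] (J → ℂ)) (S : (J → ℂ) ≃ₗ[ℂ] (K → ℂ)) (x : CoordP I) :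
    projMap (T.trans S) x = projMap S (projMap T x) := by
  induction x using Projectivization.ind with | h v hv => rfl

theorem projMap_symm_projMap (T : (I → ℂ) ≃ₗ[ℂ] (J → ℂ)) (x : CoordP I) :
    projMap T.symm (projMap T x) = x := by
  induction x using Projectivization.ind with | h v hv => simp [projMap_mk]

theorem projMap_projMap_symm (T : (I → ℂ) ≃ₗ[ℂ] (J → ℂ)) (x : CoordP J) :
    projMap T (projMap T.symm x) = x :=
  projMap_symm_projMap T.symm x

theorem projMap_injective (T : (I → ℂ) ≃ₗ[ℂ] (J → ℂ)) : Function.Injective (projMap T) :=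
  Function.LeftInverse.injective (projMap_symm_projMap T)

/-- The projective transformation given by a linear automorphism, as a permutation. -/
def projPerm (T : (I → ℂ) ≃ₗ[ℂ] (I → ℂ)) : Equiv.Perm (CoordP I) where
  toFun := projMap T
  invFun := projMap T.symm
  left_inv := projMap_symm_projMap T
  right_inv := projMap_projMap_symm T

theorem projPerm_mk (T : (I → ℂ) ≃ₗ[ℂ] (I → ℂ)) (v : I → ℂ) (hv : v ≠ 0) :
    projPerm T (mk ℂ v hv) = mk ℂ (T v) (T.map_ne_zero_iff.mpr hv) := rfl

/-- The antilinear map `y ↦ conj ∘ y ∘ π` of `ℂ^I`. -/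
def conjPerm (π : Equiv.Perm I) : (I → ℂ) →ₛₗ[starRingEnd ℂ] (I → ℂ) where
  toFun y i := starRingEnd ℂ (y (π i))
  map_add' _ _ := by ext i; simp
  map_smul' _ _ := by ext i; simp

theorem conjPerm_apply (π : Equiv.Perm I) (y : I → ℂ) (i : I) :
    conjPerm π y i = starRingEnd ℂ (y (π i)) := rfl

theorem conjPerm_injective (π : Equiv.Perm I) : Function.Injective (conjPerm π) := fun _ _ h =>
  π.surjective.injective_comp_right (funext fun i => (starRingEnd ℂ).injective (congrFun h i))

theorem continuous_conjPerm (π : Equiv.Perm I) : Continuous (conjPerm π) :=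
  continuous_pi fun i => Complex.continuous_conj.comp (continuous_apply (π i))

/-- The antiholomorphic transformation of projective space given by `conjPerm π`. -/
def projConjPerm (π : Equiv.Perm I) : CoordP I → CoordP I :=
  Projectivization.map (conjPerm π) (conjPerm_injective π)

theorem projConjPerm_mk (π : Equiv.Perm I) (v : I → ℂ) (hv : v ≠ 0) :
    projConjPerm π (mk ℂ v hv) =
      mk ℂ (conjPerm π v) ((map_ne_zero_iff (conjPerm π) (conjPerm_injective π)).mpr hv) := rfl

theorem conjP_eq_projConjPerm (n : ℕ) : conjP n = projConjPerm 1 := rfl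

end Projective

/-! ### Projective equivalence of embeddings -/

section ProjEquiv

variable {I J K Z Z' Z'' : Type*} {emb : Z → CoordP I} {emb' : Z' → CoordP J}
  {emb'' : Z'' → CoordP K}

/-- The bijection `α` identifies `emb` with `emb'` up to a projective transformation. For a subset
`X` of projective space and `emb' : X → CoordP J` the inclusion, this says that `α` parametrizes
`X` by `emb` in suitable coordinates. -/
def IsProjEquiv (emb : Z → CoordP I) (emb' : Z' → CoordP J) (α : Z ≃ Z') : Prop :=
  ∃ T : (I → ℂ) ≃ₗ[ℂ] (J → ℂ), ∀ z, emb' (α z) = projMap T (emb z)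

theorem IsProjEquiv.symm {α : Z ≃ Z'} (h : IsProjEquiv emb emb' α) :
    IsProjEquiv emb' emb α.symm := by
  obtain ⟨T, hT⟩ := h
  refine ⟨T.symm, fun z => ?_⟩
  rw [← projMap_symm_projMap T (emb _), ← hT, α.apply_symm_apply]

theorem IsProjEquiv.trans {α : Z ≃ Z'} {β : Z' ≃ Z''} (hα : IsProjEquiv emb emb' α)
    (hβ : IsProjEquiv emb' emb'' β) : IsProjEquiv emb emb'' (α.trans β) := by
  obtain ⟨T, hT⟩ := hα
  obtain ⟨S, hS⟩ := hβ
  exact ⟨T.trans S, fun z => by rw [projMap_trans, ← hT, ← hS, Equiv.trans_apply]⟩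

variable {X : Set (CoordP J)} {c : Z → Z} {σ σ' : X → X}

/-- The self-map `σ` of `X` corresponds to the self-map `c` of `Z` under some parametrization of
`X` that is projectively equivalent to `emb`. -/
def IsStandardRealStructure (emb : Z → CoordP I) (c : Z → Z) (σ : X → X) : Prop :=
  ∃ ψ : Z ≃ X, IsProjEquiv emb Subtype.val ψ ∧ Function.Semiconj ψ c σ

theorem IsProjEquiv.isStandardRealStructure_conj {φ : Z ≃ X}
    (hφ : IsProjEquiv emb Subtype.val φ) (c : Z → Z) :
    IsStandardRealStructure emb c (φ ∘ c ∘ φ.symm) :=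
  ⟨φ, hφ, fun z => by simp⟩

theorem IsStandardRealStructure.innerAutomorphicVia {φ : Z ≃ X}
    (hσ : IsStandardRealStructure emb c σ) (hσ' : IsStandardRealStructure emb c σ')
    (hφ : IsProjEquiv emb Subtype.val φ) {A : Set (Equiv.Perm Z)}
    (hA : ∀ α, IsProjEquiv emb emb α → α ∈ A) : InnerAutomorphicVia φ A σ σ' := by
  obtain ⟨ψ, hψ, hψσ⟩ := hσ
  obtain ⟨ψ', hψ', hψσ'⟩ := hσ'
  refine ⟨φ.trans (ψ'.symm.trans (ψ.trans φ.symm)),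
    hA _ (hφ.trans (hψ'.symm.trans (hψ.trans hφ.symm))), funext fun x => ?_⟩
  obtain ⟨z, rfl⟩ := ψ'.surjective x
  simp [Equiv.permCongr_def, ← hψσ.eq, ← hψσ'.eq]

end ProjEquiv

/-! ### Algebraic sets -/

section Algebraic

variable {I J σ : Type*}

/-- `V` is a Zariski closed subset of projective space: the zero locus of a family of forms. -/
def IsAlgebraicSet (V : Set (CoordP I)) : Prop :=
  ∃ S : Set (MvPolynomial I ℂ), (∀ P ∈ S, ∃ d, P.IsHomogeneous d) ∧
    ∀ (v : I → ℂ) (hv : v ≠ 0), mk ℂ v hv ∈ V ↔ ∀ P ∈ S, eval v P = 0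

/-- The pullback of the linear functional `ℓ` along the map with components `G`, which is a form
when the components are forms of one common degree. -/
def pullbackForm [Fintype I] [DecidableEq I] (G : I → MvPolynomial σ ℂ)
    (ℓ : (I → ℂ) →ₗ[ℂ] ℂ) : MvPolynomial σ ℂ :=
  ∑ i, C (ℓ (Pi.single i 1)) * G i

theorem pullbackForm_isWeightedHomogeneous [Fintype I] [DecidableEq I] {M : Type*}
    [AddCommMonoid M] {w : σ → M} {d : M} {G : I → MvPolynomial σ ℂ}
    (hG : ∀ i, (G i).IsWeightedHomogeneous w d) (ℓ : (I → ℂ) →ₗ[ℂ] ℂ) :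
    (pullbackForm G ℓ).IsWeightedHomogeneous w d :=
  IsWeightedHomogeneous.sum _ _ _ fun i _ => (hG i).C_mul _

theorem eval_pullbackForm [Fintype I] [DecidableEq I] (G : I → MvPolynomial σ ℂ)
    (ℓ : (I → ℂ) →ₗ[ℂ] ℂ) (x : σ → ℂ) :
    eval x (pullbackForm G ℓ) = ℓ fun i => eval x (G i) := by
  conv_rhs => rw [pi_eq_sum_univ' fun i => eval x (G i)]
  simp [pullbackForm, mul_comm]

theorem apply_rep_mk_eq_zero_iff (ℓ : (I → ℂ) →ₗ[ℂ] ℂ) (v : I → ℂ) (hv : v ≠ 0) :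
    ℓ (mk ℂ v hv).rep = 0 ↔ ℓ v = 0 := by
  obtain ⟨a, ha⟩ := exists_smul_eq_mk_rep ℂ v hv
  simp [← ha, Units.smul_def]

theorem isAlgebraicSet_hyperplane [Finite I] (ℓ : (I → ℂ) →ₗ[ℂ] ℂ) :
    IsAlgebraicSet {x : CoordP I | ℓ x.rep = 0} := by
  classical
  cases nonempty_fintype I
  refine ⟨{pullbackForm X ℓ}, fun P hP => ⟨1, hP ▸
    pullbackForm_isWeightedHomogeneous (isHomogeneous_X ℂ) ℓ⟩, fun v hv => ?_⟩
  simp [eval_pullbackForm, apply_rep_mk_eq_zero_iff]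

theorem IsAlgebraicSet.preimage_projMap [Finite I] {V : Set (CoordP J)} (hV : IsAlgebraicSet V)
    (T : (I → ℂ) ≃ₗ[ℂ] (J → ℂ)) : IsAlgebraicSet (projMap T ⁻¹' V) := by
  classical
  cases nonempty_fintype I
  obtain ⟨S, hS, hSV⟩ := hV
  let T' : J → MvPolynomial I ℂ := fun j =>
    pullbackForm X (LinearMap.proj j ∘ₗ T.toLinearMap)
  have heval (v : I → ℂ) (P : MvPolynomial J ℂ) : eval v (bind₁ T' P) = eval (T v) P := by
    refine (eval₂Hom_bind₁ _ v T' P).trans ?_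
    congr 1
    exact congrArg eval (funext fun j => (eval_pullbackForm _ _ v).trans (by simp))
  refine ⟨bind₁ T' '' S, ?_, fun v hv => ?_⟩
  · rintro _ ⟨P, hP, rfl⟩
    obtain ⟨d, hd⟩ := hS P hP
    exact ⟨1 * d, hd.aeval T' fun j =>
      pullbackForm_isWeightedHomogeneous (isHomogeneous_X ℂ) _⟩
  · simp [projMap_mk, hSV, heval]

theorem isAlgebraicSet_of_mul_eq_mul {κ : Type*} {V : Set (CoordP I)} (a b c d : κ → I)
    (hV : ∀ (v : I → ℂ) (hv : v ≠ 0), mk ℂ v hv ∈ V ↔ ∀ k, v (a k) * v (b k) = v (c k) * v (d k)) :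
    IsAlgebraicSet V := by
  refine ⟨Set.range fun k => X (a k) * X (b k) - X (c k) * X (d k), ?_, fun v hv => ?_⟩
  · rintro _ ⟨k, rfl⟩
    exact ⟨1 + 1, ((isHomogeneous_X ℂ _).mul (isHomogeneous_X ℂ _)).sub
      ((isHomogeneous_X ℂ _).mul (isHomogeneous_X ℂ _))⟩
  · simp [hV, sub_eq_zero]

/-- `X` is contained in the Zariski closure of `V`. -/
def IsZariskiDense (V X : Set (CoordP I)) : Prop := ∀ W, IsAlgebraicSet W → V ⊆ W → X ⊆ W

/-- The punctured affine cone over a subset of projective space. -/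
def cone (V : Set (CoordP I)) : Set (I → ℂ) := {v | ∃ hv : v ≠ 0, mk ℂ v hv ∈ V}

theorem isZariskiDense_of_cone_subset_closure {V X : Set (CoordP I)}
    (h : cone X ⊆ closure (cone V)) : IsZariskiDense V X := by
  rintro W ⟨S, -, hSW⟩ hVW x hx
  obtain ⟨v, hv, rfl⟩ := exists_mk_eq x
  refine (hSW v hv).mpr fun P hP => ?_
  have hclosed : IsClosed {v : I → ℂ | eval v P = 0} :=
    isClosed_eq (continuous_eval P) continuous_const
  refine closure_minimal ?_ hclosed (h ⟨hv, hx⟩)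
  rintro w ⟨hw, hwV⟩
  exact (hSW w hw).mp (hVW hwV) P hP

theorem IsZariskiDense.image_projMap [Finite I] {V X : Set (CoordP I)} (h : IsZariskiDense V X)
    (T : (I → ℂ) ≃ₗ[ℂ] (J → ℂ)) : IsZariskiDense (projMap T '' V) (projMap T '' X) := by
  intro W hW hVW
  rw [Set.image_subset_iff] at hVW ⊢
  exact h _ (hW.preimage_projMap T) hVW

theorem IsAlgebraicSet.image_projMap [Finite J] {V : Set (CoordP I)} (hV : IsAlgebraicSet V)
    (T : (I → ℂ) ≃ₗ[ℂ] (J → ℂ)) : IsAlgebraicSet (projMap T '' V) := by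
  have hpre : projMap T.symm ⁻¹' V = projMap T '' V := Set.ext fun x =>
    ⟨fun hx => ⟨_, hx, projMap_projMap_symm T x⟩, fun ⟨y, hy, hyx⟩ => by
      rwa [Set.mem_preimage, ← hyx, projMap_symm_projMap]⟩
  exact hpre ▸ hV.preimage_projMap T.symm

end Algebraic

/-! ### Characters of the torus -/

section Torus

theorem character_ne_zero (v : Fin 2 → ℤ) (t : Torus) : character v t ≠ 0 := Units.ne_zero _

theorem character_add (v w : Fin 2 → ℤ) (t : Torus) :
    character (v + w) t = character v t * character w t := by
  simp only [character, Pi.add_apply, zpow_add, Finset.prod_mul_distrib, Units.val_mul]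

theorem character_star (v : Fin 2 → ℤ) (t : Torus) :
    character v (star t) = starRingEnd ℂ (character v t) := by
  simp [character]

theorem character_mulSingle (v : Fin 2 → ℤ) (j : Fin 2) (u : ℂˣ) :
    character v (Pi.mulSingle j u) = (u : ℂ) ^ v j := by
  rw [character, Finset.prod_eq_single j (fun k _ hk => by simp [Pi.mulSingle_eq_of_ne hk])
    (by simp), Pi.mulSingle_eq_same, Units.val_zpow_eq_zpow_val]

/-- `character v` as a homomorphism to the multiplicative monoid of `ℂ`. -/
def characterHom (v : Fin 2 → ℤ) : Torus →* ℂ where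
  toFun := character v
  map_one' := by simp [character]
  map_mul' s t := by simp [character, mul_zpow, Finset.prod_mul_distrib]

theorem characterHom_injective : Function.Injective characterHom := by
  intro v w h
  funext j
  have hj : (2 : ℂ) ^ v j = 2 ^ w j := by
    have h2 : character v (Pi.mulSingle j (Units.mk0 2 two_ne_zero)) =
        character w (Pi.mulSingle j (Units.mk0 2 two_ne_zero)) := DFunLike.congr_fun h _
    simpa only [character_mulSingle, Units.val_mk0] using h2
  have hj' : (2 : ℝ) ^ v j = 2 ^ w j := Complex.ofReal_injective (by push_cast; exact hj)
  exact zpow_right_injective₀ two_pos (by norm_num) hj'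

theorem linearIndependent_character {I : Type*} {f : I → Fin 2 → ℤ} (hf : Function.Injective f) :
    LinearIndependent ℂ fun i => character (f i) :=
  (linearIndependent_monoidHom Torus ℂ).comp (fun i => characterHom (f i))
    (characterHom_injective.comp hf)

theorem character_single (j : Fin 2) (t : Torus) : character (Pi.single j 1) t = t j := by
  rw [character, Finset.prod_eq_single j (fun k _ hk => by simp [Pi.single_eq_of_ne hk]) (by simp),
    Pi.single_eq_same, zpow_one]

theorem torus_ext {t s : Torus} (h : ∀ v, character v t = character v s) : t = s :=
  funext fun j => Units.ext (by rw [← character_single, ← character_single, h])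

/-- The endomorphism of the torus whose pullback of characters is the linear map `B`. -/
def torusHom (B : Matrix (Fin 2) (Fin 2) ℤ) (t : Torus) : Torus := fun j => ∏ k, t k ^ B k j

theorem character_torusHom (B : Matrix (Fin 2) (Fin 2) ℤ) (v : Fin 2 → ℤ) (t : Torus) :
    character v (torusHom B t) = character (B.mulVec v) t := by
  simp only [character, torusHom, Matrix.mulVec, dotProduct, Fin.prod_univ_two, Fin.sum_univ_two,
    mul_zpow, zpow_add, zpow_mul]
  rw [mul_mul_mul_comm]

theorem torusHom_torusHom (A B : Matrix (Fin 2) (Fin 2) ℤ) (t : Torus) :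
    torusHom A (torusHom B t) = torusHom (B * A) t :=
  torus_ext fun v => by simp only [character_torusHom, Matrix.mulVec_mulVec]

theorem torusHom_one (t : Torus) : torusHom 1 t = t :=
  torus_ext fun v => by rw [character_torusHom, Matrix.one_mulVec]

theorem torusHom_surjective (A : GL (Fin 2) ℤ) :
    Function.Surjective (torusHom (A : Matrix (Fin 2) (Fin 2) ℤ)) := fun t =>
  ⟨torusHom (A⁻¹ : GL (Fin 2) ℤ) t, by
    rw [torusHom_torusHom, ← Units.val_mul, inv_mul_cancel, Units.val_one, torusHom_one]⟩

theorem star_torusHom (B : Matrix (Fin 2) (Fin 2) ℤ) (t : Torus) :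
    star (torusHom B t) = torusHom B (star t) :=
  torus_ext fun v => by simp only [character_star, character_torusHom]

theorem Induces.eq_torusHom {τ : Torus → Torus} {N : Matrix (Fin 2) (Fin 2) ℤ}
    (h : Induces τ N) (t : Torus) : τ t = torusHom N (star t) :=
  torus_ext fun v => by rw [h, character_torusHom, character_star]

theorem Induces.apply_torusHom {τ : Torus → Torus} {A M N : Matrix (Fin 2) (Fin 2) ℤ}
    (h : Induces τ N) (hAN : A * N = M * A) (t : Torus) :
    τ (torusHom A t) = torusHom A (torusHom M (star t)) := by
  rw [h.eq_torusHom, star_torusHom, torusHom_torusHom, torusHom_torusHom, hAN]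

variable {I : Type*}

/-- The coordinate vector of the point `t` in the monomial parametrization with exponents `f`. -/
def torusVec (f : I → Fin 2 → ℤ) (t : Torus) : I → ℂ := fun i => character (f i) t

theorem linearMap_eq_zero_of_torusVec [Finite I] {f : I → Fin 2 → ℤ} (hf : Function.Injective f)
    {ℓ : (I → ℂ) →ₗ[ℂ] ℂ} (hℓ : ∀ t, ℓ (torusVec f t) = 0) : ℓ = 0 := by
  classical
  cases nonempty_fintype I
  have hcoeff := Fintype.linearIndependent_iff.mp (linearIndependent_character hf)
    (fun i => ℓ (Pi.single i 1)) (funext fun t => by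
      rw [Pi.zero_apply, ← hℓ t]
      conv_rhs => rw [pi_eq_sum_univ' (torusVec f t)]
      simp [torusVec, mul_comm])
  exact LinearMap.pi_ext' fun i => LinearMap.ext_ring (hcoeff i)

variable [Nonempty I]

theorem torusVec_ne_zero (f : I → Fin 2 → ℤ) (t : Torus) : torusVec f t ≠ 0 := fun h =>
  character_ne_zero _ t (congrFun h (Classical.arbitrary I))

/-- The monomial parametrization of a projective toric variety with exponents `f`. -/
def torusPoint (f : I → Fin 2 → ℤ) (t : Torus) : CoordP I :=
  mk ℂ (torusVec f t) (torusVec_ne_zero f t)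

theorem torusPoint_torusHom_star {f : I → Fin 2 → ℤ} {M : Matrix (Fin 2) (Fin 2) ℤ}
    {π : Equiv.Perm I} (hπ : ∀ i, f (π i) = M.mulVec (f i)) (t : Torus) :
    torusPoint f (torusHom M (star t)) = projConjPerm π (torusPoint f t) := by
  have hvec : torusVec f (torusHom M (star t)) = conjPerm π (torusVec f t) := funext fun i => by
    rw [conjPerm_apply, torusVec, torusVec, hπ, character_torusHom, character_star]
  simp only [torusPoint, projConjPerm_mk, hvec]

end Torus

/-! ### Toric models -/

section ToricModel

variable {I J Z : Type*} [Nonempty I]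

/-- `emb` embeds `Z` in projective space as the closed toric variety with exponents `f`, the torus
being embedded in `Z` by `ι`. Density is required of affine cones in the classical topology, which
serves both for polynomial identities and for identities between continuous maps. -/
structure IsToricModel (emb : Z → CoordP I) (f : I → Fin 2 → ℤ) (ι : Torus → Z) : Prop where
  injective : Function.Injective emb
  isAlgebraicSet_range : IsAlgebraicSet (Set.range emb)
  emb_torus : ∀ t, emb (ι t) = torusPoint f t
  cone_subset_closure : cone (Set.range emb) ⊆ closure (cone (emb '' Set.range ι))

variable {emb : Z → CoordP I} {f : I → Fin 2 → ℤ} {ι : Torus → Z}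

theorem IsToricModel.isZariskiDense (hM : IsToricModel emb f ι) :
    IsZariskiDense (Set.range (torusPoint f)) (Set.range emb) := by
  have hrange : emb '' Set.range ι = Set.range (torusPoint f) := by
    rw [← Set.range_comp]
    exact congrArg Set.range (funext hM.emb_torus)
  exact hrange ▸ isZariskiDense_of_cone_subset_closure hM.cone_subset_closure

theorem IsToricModel.exists_equiv_projMap [Finite I] [Finite J] {X : Set (CoordP J)}
    (hM : IsToricModel emb f ι) {φ : Z ≃ X} (hφ : IsProjEquiv emb Subtype.val φ)
    (G : (I → ℂ) ≃ₗ[ℂ] (J → ℂ))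
    (hGX : ∀ t, projMap G (torusPoint f t) ∈ X)
    (hdense : IsZariskiDense (projMap G '' Set.range (torusPoint f)) X) :
    ∃ ψ : Z ≃ X, ∀ z, (ψ z : CoordP J) = projMap G (emb z) := by
  have hX : IsAlgebraicSet X := by
    obtain ⟨H, hH⟩ := hφ
    have hXH : projMap H '' Set.range emb = X := by
      rw [← Set.range_comp, ← Subtype.range_coe (s := X), ← φ.surjective.range_comp]
      exact congrArg Set.range (funext fun z => (hH z).symm)
    exact hXH ▸ hM.isAlgebraicSet_range.image_projMap H
  have hle : projMap G '' Set.range emb ⊆ X := by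
    refine hM.isZariskiDense.image_projMap G X hX ?_
    rintro _ ⟨_, ⟨t, rfl⟩, rfl⟩
    exact hGX t
  have hge : X ⊆ projMap G '' Set.range emb := by
    refine hdense _ (hM.isAlgebraicSet_range.image_projMap G) (Set.image_mono ?_)
    rintro _ ⟨t, rfl⟩
    exact ⟨ι t, hM.emb_torus t⟩
  refine ⟨Equiv.ofBijective (fun z => ⟨projMap G (emb z), hle ⟨_, ⟨z, rfl⟩, rfl⟩⟩)
    ⟨fun z z' h => hM.injective (projMap_injective G (congrArg Subtype.val h)), ?_⟩, fun z => rfl⟩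
  rintro ⟨x, hx⟩
  obtain ⟨_, ⟨z, rfl⟩, hz⟩ := hge hx
  exact ⟨z, Subtype.ext hz⟩

theorem IsToricModel.eq_zero_of_forall_rep [Finite I] (hM : IsToricModel emb f ι)
    (hf : Function.Injective f) {X : Set (CoordP J)} {φ : Z ≃ X}
    (hφ : IsProjEquiv emb Subtype.val φ) {ℓ : (J → ℂ) →ₗ[ℂ] ℂ}
    (hℓ : ∀ x ∈ X, ℓ x.rep = 0) : ℓ = 0 := by
  obtain ⟨H, hH⟩ := hφ
  have hHℓ : ℓ ∘ₗ H.toLinearMap = 0 := linearMap_eq_zero_of_torusVec hf fun t => by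
    have ht := hℓ _ (φ (ι t)).2
    rwa [hH, hM.emb_torus, torusPoint, projMap_mk, apply_rep_mk_eq_zero_iff] at ht
  exact LinearMap.ext fun v => by simpa using LinearMap.congr_fun hHℓ (H.symm v)

end ToricModel

/-! ### Toric parametrizations and real structures -/

section NormalForm

variable {n : ℕ} {X : Set (CP n)}

theorem IsToricParametrization.isZariskiDense {e : Fin (n + 1) → Fin 2 → ℤ}
    {g : GL (Fin (n + 1)) ℂ} {p : Torus → X} (hp : IsToricParametrization e g p) :
    IsZariskiDense (Set.range fun t => (p t : CP n)) X := by
  rintro W ⟨S, hS, hSW⟩ hW x hx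
  rw [← mk_rep x, hSW _ x.rep_nonzero]
  intro P hP
  obtain ⟨d, hd⟩ := hS P hP
  refine hp.dense d P hd (fun t => ?_) x hx
  exact (hSW _ (p t : CP n).rep_nonzero).mp (by rw [mk_rep]; exact hW ⟨t, rfl⟩) P hP

/-- The linear isomorphism given by an invertible matrix. -/
def mulVecEquiv {I : Type*} [Fintype I] [DecidableEq I] (B : GL I ℂ) : (I → ℂ) ≃ₗ[ℂ] (I → ℂ) :=
  Matrix.toLin'OfInv (M := B⁻¹.val) (M' := B.val)
      (by rw [← Units.val_mul]; simp) (by rw [← Units.val_mul]; simp)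

theorem IsToricParametrization.val_eq {e : Fin (n + 1) → Fin 2 → ℤ}
    {g : GL (Fin (n + 1)) ℂ} {p : Torus → X} (hp : IsToricParametrization e g p) (t : Torus) :
    (p t : CP n) = projMap (mulVecEquiv g) (torusPoint e t) :=
  (hp.monomial t).2

theorem IsToricParametrization.exponents_injective {e : Fin (n + 1) → Fin 2 → ℤ}
    {g : GL (Fin (n + 1)) ℂ} {p : Torus → X} (hp : IsToricParametrization e g p)
    (hX : ∀ ℓ : (Fin (n + 1) → ℂ) →ₗ[ℂ] ℂ, (∀ x ∈ X, ℓ x.rep = 0) → ℓ = 0) :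
    Function.Injective e := by
  intro i j hij
  by_contra hne
  let ℓ : (Fin (n + 1) → ℂ) →ₗ[ℂ] ℂ :=
    (LinearMap.proj (R := ℂ) (φ := fun _ => ℂ) i - LinearMap.proj j) ∘ₗ
      (mulVecEquiv g).symm.toLinearMap
  have hℓ : ℓ = 0 := by
    refine hX ℓ (hp.isZariskiDense _ (isAlgebraicSet_hyperplane ℓ) ?_)
    rintro _ ⟨t, rfl⟩
    change ℓ (p t : CP n).rep = 0
    rw [hp.val_eq, torusPoint, projMap_mk, apply_rep_mk_eq_zero_iff]
    simp [ℓ, torusVec, hij]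
  have h1 := LinearMap.congr_fun hℓ (mulVecEquiv g (Pi.single i 1))
  simp [ℓ, Pi.single_eq_of_ne (Ne.symm hne)] at h1

theorem exists_equiv_of_mapsTo_latticePolygon {e : Fin (n + 1) → Fin 2 → ℤ}
    (he : Function.Injective e) {Q : Set (Fin 2 → ℝ)} {A : GL (Fin 2) ℤ} {c : Fin 2 → ℤ}
    (hAQ : Set.MapsTo (fun x : Fin 2 → ℝ =>
      ((A : Matrix (Fin 2) (Fin 2) ℤ).map (Int.cast : ℤ → ℝ)).mulVec x + fun j => (c j : ℝ))
      (latticePolygon e) Q)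
    {I : Type*} [Fintype I] {f : I → Fin 2 → ℤ} (hcard : Fintype.card I = n + 1)
    (hQ : ∀ v : Fin 2 → ℤ, (fun j => (v j : ℝ)) ∈ Q → v ∈ Set.range f) :
    ∃ E : Fin (n + 1) ≃ I, ∀ i, f (E i) = (A : Matrix (Fin 2) (Fin 2) ℤ).mulVec (e i) + c := by
  have hmem (i) : (A : Matrix (Fin 2) (Fin 2) ℤ).mulVec (e i) + c ∈ Set.range f := by
    refine hQ _ ?_
    convert hAQ (subset_convexHull ℝ _ ⟨i, rfl⟩) using 1
    funext j
    fin_cases j <;> simp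
  choose ε hε using hmem
  have hεinj : Function.Injective ε := fun i j hij =>
    he (Matrix.mulVec_injective_of_isUnit A.isUnit
      (add_right_cancel ((hε i).symm.trans ((congrArg f hij).trans (hε j)))))
  exact ⟨Equiv.ofBijective ε ((Fintype.bijective_iff_injective_and_card ε).mpr
    ⟨hεinj, by simp [hcard]⟩), hε⟩

theorem IsToricParametrization.val_torusHom {I : Type*} [Nonempty I]
    {e : Fin (n + 1) → Fin 2 → ℤ} {g : GL (Fin (n + 1)) ℂ} {p : Torus → X}
    (hp : IsToricParametrization e g p) {A : Matrix (Fin 2) (Fin 2) ℤ} {c : Fin 2 → ℤ}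
    {f : I → Fin 2 → ℤ} {E : Fin (n + 1) ≃ I} (hE : ∀ i, f (E i) = A.mulVec (e i) + c)
    (t : Torus) : (p (torusHom A t) : CP n) =
      projMap ((LinearEquiv.funCongrLeft ℂ ℂ E).trans (mulVecEquiv g)) (torusPoint f t) := by
  rw [hp.val_eq, projMap_trans]
  congr 1
  simp only [torusPoint, projMap_mk]
  rw [eq_comm, mk_eq_mk_iff']
  refine ⟨character c t, funext fun i => ?_⟩
  rw [Pi.smul_apply, smul_eq_mul, LinearEquiv.funCongrLeft_apply, LinearMap.funLeft_apply,
    torusVec, torusVec, character_torusHom, hE, character_add, mul_comm]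

theorem ActsAs.exists_normalForm {I : Type*} [Fintype I] [Nonempty I] {σ : X → X}
    {Q : Set (Fin 2 → ℝ)} {M : Matrix (Fin 2) (Fin 2) ℤ} (h : ActsAs σ Q M)
    (hX : ∀ ℓ : (Fin (n + 1) → ℂ) →ₗ[ℂ] ℂ, (∀ x ∈ X, ℓ x.rep = 0) → ℓ = 0)
    {f : I → Fin 2 → ℤ} (hcard : Fintype.card I = n + 1)
    (hQ : ∀ v : Fin 2 → ℤ, (fun j => (v j : ℝ)) ∈ Q → v ∈ Set.range f) :
    ∃ (G : (I → ℂ) ≃ₗ[ℂ] (Fin (n + 1) → ℂ)) (p : Torus → X),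
      (∀ t, (p t : CP n) = projMap G (torusPoint f t)) ∧
        IsZariskiDense (projMap G '' Set.range (torusPoint f)) X ∧
          ∀ t, σ (p t) = p (torusHom M (star t)) := by
  obtain ⟨e, g, p, τ, N, hp, hσ, hτ, A, c, rfl, hAN⟩ := h
  obtain ⟨E, hE⟩ := exists_equiv_of_mapsTo_latticePolygon (hp.exponents_injective hX)
    (Set.mapsTo_image _ _) hcard hQ
  refine ⟨(LinearEquiv.funCongrLeft ℂ ℂ E).trans (mulVecEquiv g), fun t => p (torusHom A t),
    hp.val_torusHom hE, ?_, fun t => ?_⟩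
  · have hrange : projMap ((LinearEquiv.funCongrLeft ℂ ℂ E).trans (mulVecEquiv g)) ''
        Set.range (torusPoint f) = Set.range fun t => (p t : CP n) := by
      rw [← Set.range_comp, ← (torusHom_surjective A).range_comp fun t => (p t : CP n)]
      exact congrArg Set.range (funext fun t => (hp.val_torusHom hE t).symm)
    exact hrange ▸ hp.isZariskiDense
  · rw [hσ, hτ.apply_torusHom hAN]

theorem mul_eq_mul_of_mem_closure {E J : Type*} [TopologicalSpace E] {g h : E → J → ℂ}
    {S : Set E} {y : E} (hy : y ∈ closure S) (hg : ContinuousAt g y) (hh : ContinuousAt h y)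
    (hS : ∀ᶠ x in 𝓝 y, x ∈ S → ∀ i j, g x i * h x j = g x j * h x i) (i j : J) :
    g y i * h y j = g y j * h y i := by
  have hgi (i) : ContinuousAt (fun x => g x i) y := (continuous_apply i).continuousAt.comp hg
  have hhi (i) : ContinuousAt (fun x => h x i) y := (continuous_apply i).continuousAt.comp hh
  have : (𝓝[S] y).NeBot := mem_closure_iff_nhdsWithin_neBot.mp hy
  refine tendsto_nhds_unique_of_eventuallyEq (l := 𝓝[S] y)
    (((hgi i).mul (hhi j)).tendsto.mono_left nhdsWithin_le_nhds)
    (((hgi j).mul (hhi i)).tendsto.mono_left nhdsWithin_le_nhds) ?_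
  filter_upwards [nhdsWithin_le_nhds hS, self_mem_nhdsWithin] with x hx hxS
  exact hx hxS i j

theorem mul_eq_mul_of_mk_eq_mk {I : Type*} {u w : I → ℂ} {hu : u ≠ 0} {hw : w ≠ 0}
    (h : mk ℂ u hu = mk ℂ w hw) (i j : I) : u i * w j = u j * w i := by
  obtain ⟨a, rfl⟩ := (mk_eq_mk_iff' ℂ _ _ hu hw).mp h
  simp only [Pi.smul_apply, smul_eq_mul]
  ring

theorem IsAntiholomorphic.apply_eq_of_dense {I Z : Type*} [Finite I] {σ : X → X}
    (hσ : IsAntiholomorphic σ) {emb : Z → CoordP I} {ψ : Z → X}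
    {G : (I → ℂ) ≃ₗ[ℂ] (Fin (n + 1) → ℂ)} (hψ : ∀ z, (ψ z : CP n) = projMap G (emb z))
    {π : Equiv.Perm I} {D : Set Z} (hdense : cone (Set.range emb) ⊆ closure (cone (emb '' D)))
    (hD : ∀ z ∈ D, (σ (ψ z) : CP n) = projMap G (projConjPerm π (emb z))) (z : Z) :
    (σ (ψ z) : CP n) = projMap G (projConjPerm π (emb z)) := by
  obtain ⟨y, hy, hyz⟩ := exists_mk_eq (emb z)
  have hG : Continuous G := LinearMap.continuous_of_finiteDimensional G.toLinearMap
  have hval {x : I → ℂ} {hx : x ≠ 0} {z : Z} (hxz : mk ℂ x hx = emb z) :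
      (ψ z : CP n) = mk ℂ (G x) (G.map_ne_zero_iff.mpr hx) := by rw [hψ, ← hxz, projMap_mk]
  obtain ⟨U, F, hU, hyU, hF, hσF⟩ := hσ (G y) (G.map_ne_zero_iff.mpr hy) (hval hyz ▸ (ψ z).2)
  have hσψ {x : I → ℂ} {hx : x ≠ 0} {z : Z} (hxz : mk ℂ x hx = emb z) (hxU : G x ∈ U) :
      ∃ h, (σ (ψ z) : CP n) = mk ℂ (fun i => starRingEnd ℂ (F (G x) i)) h := by
    obtain ⟨h, hh⟩ := hσF (G x) (G.map_ne_zero_iff.mpr hx) (hval hxz ▸ (ψ z).2) hxU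
    exact ⟨h, by rw [← hh]; exact congrArg (fun x => (σ x : CP n)) (Subtype.ext (hval hxz))⟩
  obtain ⟨h, hh⟩ := hσψ hyz hyU
  have hFG : ContinuousAt (fun x => F (G x)) y :=
    ContinuousAt.comp (f := G) (hF.continuousOn.continuousAt (hU.mem_nhds hyU)) hG.continuousAt
  rw [hh, ← hyz, projConjPerm_mk, projMap_mk]
  refine mk_eq_mk_of_mul_eq_mul _ _ (mul_eq_mul_of_mem_closure (hdense ⟨hy, z, hyz.symm⟩)
    (g := fun x i => starRingEnd ℂ (F (G x) i)) (h := fun x => G (conjPerm π x))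
    (continuousAt_pi.mpr fun i => Complex.continuous_conj.continuousAt.comp
      ((continuous_apply i).continuousAt.comp hFG))
    (hG.comp (continuous_conjPerm π)).continuousAt ?_)
  filter_upwards [hG.continuousAt.eventually (hU.mem_nhds hyU)] with x hxU
  rintro ⟨hx, z', hz', hxz'⟩
  obtain ⟨h', hh'⟩ := hσψ hxz'.symm hxU
  rw [hD z' hz', hxz', projConjPerm_mk, projMap_mk] at hh'
  exact mul_eq_mul_of_mk_eq_mk hh'.symm

theorem IsToricModel.isStandardRealStructure {I Z : Type*} [Fintype I] [Nonempty I]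
    {emb : Z → CoordP I} {f : I → Fin 2 → ℤ} {ι : Torus → Z} (hM : IsToricModel emb f ι)
    (hf : Function.Injective f) (hcard : Fintype.card I = n + 1) {Q : Set (Fin 2 → ℝ)}
    (hQ : ∀ v : Fin 2 → ℤ, (fun j => (v j : ℝ)) ∈ Q → v ∈ Set.range f)
    {φ : Z ≃ X} (hφ : IsProjEquiv emb Subtype.val φ)
    {σ : X → X} (hσ : IsAntiholomorphic σ) {M : Matrix (Fin 2) (Fin 2) ℤ} (h : ActsAs σ Q M)
    {π : Equiv.Perm I} (hπ : ∀ i, f (π i) = M.mulVec (f i))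
    {β : Equiv.Perm Z} (hβ : IsProjEquiv emb emb β) {c : Z → Z}
    (hc : ∀ z, projConjPerm π (emb (β z)) = emb (β (c z))) :
    IsStandardRealStructure emb c σ := by
  obtain ⟨G, p, hp, hdense, hσp⟩ :=
    h.exists_normalForm (fun _ => hM.eq_zero_of_forall_rep hf hφ) hcard hQ
  obtain ⟨ψ, hψ⟩ := hM.exists_equiv_projMap hφ G (fun t => hp t ▸ (p t).2) hdense
  have hσψ := hσ.apply_eq_of_dense hψ hM.cone_subset_closure (π := π) (by
    rintro _ ⟨t, rfl⟩
    have hψp : ψ (ι t) = p t := Subtype.ext (by rw [hψ, hM.emb_torus, hp])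
    rw [hψp, hσp, hp, torusPoint_torusHom_star hπ, hM.emb_torus])
  refine ⟨β.trans ψ, hβ.trans ⟨G, hψ⟩, fun z => Subtype.ext ?_⟩
  rw [Equiv.trans_apply, Equiv.trans_apply, hσψ, hc, ← hψ]

end NormalForm

/-! ### Straightening permuted conjugations -/

section Straighten

variable {I : Type*}

/-- The linear automorphism `a + ā s` of `ℂ^I` with `a = (1 + i) / 2`, which carries `conj` to
`conj ∘ s`. Its inverse is its complex conjugate because `a² + ā² = 0` and `2 |a|² = 1`. -/
def straighten (s : Equiv.Perm I) (hs : Function.Involutive s) : (I → ℂ) ≃ₗ[ℂ] (I → ℂ) where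
  toFun v i := (1 + Complex.I) / 2 * v i + (1 - Complex.I) / 2 * v (s i)
  map_add' v w := by ext i; simp only [Pi.add_apply]; ring
  map_smul' c v := by ext i; simp only [Pi.smul_apply, smul_eq_mul, RingHom.id_apply]; ring
  invFun v i := (1 - Complex.I) / 2 * v i + (1 + Complex.I) / 2 * v (s i)
  left_inv v := by
    ext i
    simp only [hs i]
    linear_combination (v (s i) - v i) / 2 * Complex.I_sq
  right_inv v := by
    ext i
    simp only [hs i]
    linear_combination (v (s i) - v i) / 2 * Complex.I_sq

theorem conjPerm_straighten (s : Equiv.Perm I) (hs : Function.Involutive s) (v : I → ℂ) :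
    conjPerm s (straighten s hs v) = straighten s hs (conjPerm 1 v) := by
  ext i
  simp [straighten, conjPerm_apply, hs i, add_comm, sub_eq_add_neg, Complex.conj_ofNat]

theorem projConjPerm_projPerm_straighten (s : Equiv.Perm I) (hs : Function.Involutive s)
    (x : CoordP I) : projConjPerm s (projPerm (straighten s hs) x) =
      projPerm (straighten s hs) (projConjPerm 1 x) := by
  obtain ⟨v, hv, rfl⟩ := exists_mk_eq x
  simp only [projPerm_mk, projConjPerm_mk, conjPerm_straighten]

end Straighten

/-! ### Bases of spaces of forms -/

section Forms

theorem exists_linearEquiv_apply_of_span_eq {ι κ V : Type*} [AddCommGroup V] [Module ℂ V]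
    {F : ι → V} {G : κ → V} (hF : LinearIndependent ℂ F) (hG : LinearIndependent ℂ G)
    (hspan : Submodule.span ℂ (Set.range F) = Submodule.span ℂ (Set.range G)) :
    ∃ H : (κ → ℂ) ≃ₗ[ℂ] (ι → ℂ), ∀ ℓ : V →ₗ[ℂ] ℂ, (fun i => ℓ (F i)) = H fun j => ℓ (G j) := by
  let bF := Module.Basis.span hF
  let bG := (Module.Basis.span hG).map (LinearEquiv.ofEq _ _ hspan.symm)
  have hbF (i) : (bF i : V) = F i := congrArg Subtype.val (Module.Basis.span_apply hF i)
  have hbG (j) : (bG j : V) = G j := by simp [bG, Module.Basis.span_apply]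
  refine ⟨(bG.constr ℂ).trans (bF.constr ℂ).symm, fun ℓ => funext fun i => ?_⟩
  rw [LinearEquiv.trans_apply, bG.constr_eq ℂ (f := ℓ ∘ₗ Submodule.subtype _)
    (fun j => by simp [hbG]), Module.Basis.constr_symm_apply]
  simp [hbF]

theorem exists_linearEquiv_eval {σ I : Type*} {M : Type*} [AddCommMonoid M] {w : σ → M} {d : M}
    {mono : I → σ →₀ ℕ} (hinj : Function.Injective mono)
    (hrange : Set.range mono = {m | Finsupp.weight w m = d}) {ι : Type*}
    {F : ι → MvPolynomial σ ℂ} (hF : LinearIndependent ℂ F)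
    (hspan : Submodule.span ℂ (Set.range F) = weightedHomogeneousSubmodule ℂ w d) :
    ∃ H : (I → ℂ) ≃ₗ[ℂ] (ι → ℂ), ∀ x : σ → ℂ,
      (fun i => eval x (F i)) = H fun j => eval x (monomial (mono j) 1) := by
  have hmono : LinearIndependent ℂ fun j => (monomial (mono j) 1 : MvPolynomial σ ℂ) :=
    (coe_basisMonomials σ ℂ ▸ (basisMonomials σ ℂ).linearIndependent).comp mono hinj
  have hspan' : weightedHomogeneousSubmodule ℂ w d =
      Submodule.span ℂ (Set.range fun j => (monomial (mono j) 1 : MvPolynomial σ ℂ)) := by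
    rw [weightedHomogeneousSubmodule_eq_finsupp_supported,
      AddMonoidAlgebra.supported_eq_span_single, ← hrange, ← Set.range_comp]
    rfl
  obtain ⟨H, hH⟩ := exists_linearEquiv_apply_of_span_eq hF hmono (hspan.trans hspan')
  exact ⟨H, fun x => hH (aeval x).toLinearMap⟩

end Forms

/-! ### The Veronese embedding -/

section Veronese

variable {σ : Type*}

/-- The vector of the quadratic monomials `v a * v b`, indexed by unordered pairs. -/
def veroneseVec (v : σ → ℂ) : Sym2 σ → ℂ := fun q => (q.map v).mul

theorem veroneseVec_mk (v : σ → ℂ) (a b : σ) : veroneseVec v s(a, b) = v a * v b := rfl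

theorem veroneseVec_ne_zero {v : σ → ℂ} (hv : v ≠ 0) : veroneseVec v ≠ 0 := by
  obtain ⟨a, ha⟩ := Function.ne_iff.mp hv
  exact Function.ne_iff.mpr ⟨s(a, a), mul_ne_zero ha ha⟩

theorem veroneseVec_smul (c : ℂ) (v : σ → ℂ) : veroneseVec (c • v) = (c * c) • veroneseVec v := by
  funext q
  induction q with | _ a b => exact mul_mul_mul_comm c (v a) c (v b)

theorem continuous_veroneseVec : Continuous (veroneseVec : (σ → ℂ) → Sym2 σ → ℂ) := by
  refine continuous_pi fun q => ?_
  induction q with | _ a b => exact (continuous_apply a).mul (continuous_apply b)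

/-- The Veronese embedding of degree two of projective space. -/
def veroneseEmb (x : CoordP σ) : CoordP (Sym2 σ) :=
  mk ℂ (veroneseVec x.rep) (veroneseVec_ne_zero x.rep_nonzero)

theorem veroneseEmb_mk (v : σ → ℂ) (hv : v ≠ 0) :
    veroneseEmb (mk ℂ v hv) = mk ℂ (veroneseVec v) (veroneseVec_ne_zero hv) := by
  obtain ⟨a, ha⟩ := exists_smul_eq_mk_rep ℂ v hv
  rw [veroneseEmb, mk_eq_mk_iff']
  exact ⟨(a * a : ℂ), by rw [← veroneseVec_smul, ← ha]; rfl⟩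

theorem exists_veroneseVec_eq {y : Sym2 σ → ℂ} {hy : y ≠ 0} {x : CoordP σ}
    (hx : veroneseEmb x = mk ℂ y hy) : ∃ (v : σ → ℂ) (hv : v ≠ 0),
      mk ℂ v hv = x ∧ veroneseVec v = y := by
  obtain ⟨v, hv, rfl⟩ := exists_mk_eq x
  rw [veroneseEmb_mk, eq_comm, mk_eq_mk_iff'] at hx
  obtain ⟨a, rfl⟩ := hx
  obtain ⟨r, rfl⟩ := IsAlgClosed.exists_eq_mul_self a
  have hr : r ≠ 0 := by
    rintro rfl
    exact hy (by rw [zero_mul, zero_smul])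
  exact ⟨r • v, smul_ne_zero hr hv, (mk_eq_mk_iff' ℂ _ _ _ _).mpr ⟨r, rfl⟩, veroneseVec_smul r v⟩

/-- The symmetric matrix with the entries `y`. -/
def symMatrix (y : Sym2 σ → ℂ) : Matrix σ σ ℂ := Matrix.of fun a b => y s(a, b)

theorem symMatrix_injective : Function.Injective (symMatrix (σ := σ)) := by
  intro y y' h
  funext q
  induction q with | _ a b => exact congrFun (congrFun h a) b

theorem symMatrix_veroneseVec (v : σ → ℂ) : symMatrix (veroneseVec v) = Matrix.vecMulVec v v := rfl

theorem exists_symMatrix_ne_zero {y : Sym2 σ → ℂ} (hy : y ≠ 0) : ∃ a, symMatrix y a ≠ 0 :=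
  Function.ne_iff.mp (symMatrix_injective.ne hy)

theorem eq_mk_symMatrix {x : CoordP σ} {y : Sym2 σ → ℂ} {hy : y ≠ 0}
    (h : veroneseEmb x = mk ℂ y hy) {a : σ} (ha : symMatrix y a ≠ 0) :
    x = mk ℂ (symMatrix y a) ha := by
  obtain ⟨v, hv, rfl, rfl⟩ := exists_veroneseVec_eq h
  refine mk_eq_mk_of_mul_eq_mul hv ha fun i j => ?_
  simp only [symMatrix_veroneseVec, Matrix.vecMulVec_apply]
  ring

theorem veroneseEmb_injective : Function.Injective (veroneseEmb (σ := σ)) := by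
  intro x x' h
  obtain ⟨y, hy, hyx⟩ := exists_mk_eq (veroneseEmb x')
  obtain ⟨a, ha⟩ := exists_symMatrix_ne_zero hy
  rw [eq_mk_symMatrix (h.trans hyx.symm) ha, eq_mk_symMatrix hyx.symm ha]

theorem mk_mem_range_veroneseEmb_iff (y : Sym2 σ → ℂ) (hy : y ≠ 0) :
    mk ℂ y hy ∈ Set.range veroneseEmb ↔
      ∀ k : Fin 4 → σ, y s(k 0, k 1) * y s(k 2, k 3) = y s(k 0, k 2) * y s(k 1, k 3) := by
  constructor
  · rintro ⟨x, hx⟩ k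
    obtain ⟨v, -, -, rfl⟩ := exists_veroneseVec_eq hx
    simp only [veroneseVec_mk]
    ring
  · intro h
    obtain ⟨a, ha⟩ := exists_symMatrix_ne_zero hy
    refine ⟨mk ℂ (symMatrix y a) ha, ?_⟩
    rw [veroneseEmb_mk, mk_eq_mk_iff']
    refine ⟨y s(a, a), funext fun q => ?_⟩
    induction q with | _ c d => exact h ![a, a, c, d]

theorem isAlgebraicSet_range_veroneseEmb : IsAlgebraicSet (Set.range (veroneseEmb (σ := σ))) :=
  isAlgebraicSet_of_mul_eq_mul (fun k : Fin 4 → σ => s(k 0, k 1)) (fun k => s(k 2, k 3))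
    (fun k => s(k 0, k 2)) (fun k => s(k 1, k 3)) mk_mem_range_veroneseEmb_iff

/-- The permutation of unordered pairs induced by a permutation. -/
def symPerm (s : Equiv.Perm σ) : Equiv.Perm (Sym2 σ) where
  toFun := Sym2.map s
  invFun := Sym2.map s.symm
  left_inv q := by simp [Sym2.map_map]
  right_inv q := by simp [Sym2.map_map]

theorem projConjPerm_veroneseEmb (s : Equiv.Perm σ) (x : CoordP σ) :
    projConjPerm (symPerm s) (veroneseEmb x) = veroneseEmb (projConjPerm s x) := by
  obtain ⟨v, hv, rfl⟩ := exists_mk_eq x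
  have hvec : conjPerm (symPerm s) (veroneseVec v) = veroneseVec (conjPerm s v) := by
    funext q
    induction q with | _ a b => exact map_mul (starRingEnd ℂ) (v (s a)) (v (s b))
  simp only [veroneseEmb_mk, projConjPerm_mk, hvec]

/-- The action of the matrix `B` on quadratic monomials, which in terms of symmetric matrices is
`Y ↦ B Y Bᵀ`. -/
def symMap [Fintype σ] (B : Matrix σ σ ℂ) : (Sym2 σ → ℂ) →ₗ[ℂ] (Sym2 σ → ℂ) where
  toFun y := Sym2.lift ⟨(B * symMatrix y * B.transpose : Matrix σ σ ℂ), fun a b => by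
    have hsymm : (symMatrix y).transpose = symMatrix y :=
      Matrix.ext fun i j => congrArg y Sym2.eq_swap
    conv_lhs => rw [← hsymm, ← Matrix.transpose_transpose (_ * _)]
    simp [Matrix.mul_assoc]⟩
  map_add' y y' := symMatrix_injective
    (show B * (symMatrix y + symMatrix y') * B.transpose = _ by rw [mul_add, add_mul]; rfl)
  map_smul' c y := symMatrix_injective
    (show B * (c • symMatrix y) * B.transpose = _ by rw [Matrix.mul_smul, Matrix.smul_mul]; rfl)

theorem symMatrix_symMap [Fintype σ] (B : Matrix σ σ ℂ) (y : Sym2 σ → ℂ) :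
    symMatrix (symMap B y) = B * symMatrix y * B.transpose := rfl

theorem symMap_comp_symMap [Fintype σ] [DecidableEq σ] {B B' : Matrix σ σ ℂ} (h : B * B' = 1) :
    symMap B ∘ₗ symMap B' = LinearMap.id := LinearMap.ext fun y => symMatrix_injective <| by
  calc symMatrix (symMap B (symMap B' y))
      = (B * B') * symMatrix y * (B * B').transpose := by
        simp only [symMatrix_symMap, Matrix.transpose_mul, Matrix.mul_assoc]
    _ = symMatrix y := by rw [h, Matrix.transpose_one, one_mul, mul_one]

theorem symMap_veroneseVec [Fintype σ] (B : Matrix σ σ ℂ) (v : σ → ℂ) :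
    symMap B (veroneseVec v) = veroneseVec (B.mulVec v) := symMatrix_injective <| by
  rw [symMatrix_symMap, symMatrix_veroneseVec, symMatrix_veroneseVec, Matrix.mul_vecMulVec,
    Matrix.vecMulVec_mul, Matrix.vecMul_transpose]

theorem isProjEquiv_veroneseEmb_projPerm [Finite σ] (T : (σ → ℂ) ≃ₗ[ℂ] (σ → ℂ)) :
    IsProjEquiv veroneseEmb veroneseEmb (projPerm T) := by
  classical
  cases nonempty_fintype σ
  let B := LinearMap.toMatrix' T.toLinearMap
  let B' := LinearMap.toMatrix' T.symm.toLinearMap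
  have hBB' : B * B' = 1 := by simp [B, B', ← LinearMap.toMatrix'_comp]
  have hB'B : B' * B = 1 := by simp [B, B', ← LinearMap.toMatrix'_comp]
  refine ⟨LinearEquiv.ofLinearMap (symMap B) (symMap B') (symMap_comp_symMap hBB')
    (symMap_comp_symMap hB'B), fun x => ?_⟩
  obtain ⟨v, hv, rfl⟩ := exists_mk_eq x
  have hBv : symMap B (veroneseVec v) = veroneseVec (T v) := by
    rw [symMap_veroneseVec, LinearMap.toMatrix'_mulVec, LinearEquiv.coe_coe]
  simp only [projPerm_mk, veroneseEmb_mk, projMap_mk, LinearEquiv.coe_ofLinearMap, hBv]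

/-- The exponent of the quadratic monomial given by an unordered pair. -/
def symExp [DecidableEq σ] (q : Sym2 σ) : σ →₀ ℕ :=
  Multiset.toFinsupp (Sym2.equivSym σ q : Multiset σ)

theorem symExp_mk [DecidableEq σ] (a b : σ) :
    symExp s(a, b) = Finsupp.single a 1 + Finsupp.single b 1 := by
  rw [← Multiset.toFinsupp_singleton, ← Multiset.toFinsupp_singleton, ← Multiset.toFinsupp_add]
  rfl

theorem symExp_injective [DecidableEq σ] : Function.Injective (symExp (σ := σ)) :=
  Multiset.toFinsupp.injective.comp
    (Subtype.val_injective.comp (Sym2.equivSym σ).injective)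

theorem range_symExp [DecidableEq σ] : Set.range (symExp (σ := σ)) = {d | d.degree = 2} := by
  ext d
  constructor
  · rintro ⟨q, rfl⟩
    induction q with | _ a b => simp [symExp_mk]
  · intro hd
    have hcard : (Finsupp.toMultiset d).card = 2 := (Finsupp.card_toMultiset d).trans hd
    obtain ⟨q, hq⟩ := (Sym2.equivSym σ).surjective ⟨Finsupp.toMultiset d, hcard⟩
    exact ⟨q, by rw [symExp, hq]; exact Finsupp.toMultiset_toFinsupp d⟩

theorem eval_monomial_symExp [DecidableEq σ] (v : σ → ℂ) (q : Sym2 σ) :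
    eval v (monomial (symExp q) 1) = veroneseVec v q := by
  induction q with
  | _ a b =>
    rw [symExp_mk, ← one_mul (1 : ℂ), ← monomial_mul, map_mul, ← X, ← X, eval_X, eval_X,
      veroneseVec_mk]

end Veronese

/-! ### Veronese surfaces -/

theorem IsProjEquiv.isRegularMap {k : ℕ} {α : Equiv.Perm (CP k)}
    (h : IsProjEquiv veroneseEmb veroneseEmb α) : IsRegularMap α := by
  intro v hv
  obtain ⟨T, hT⟩ := h
  obtain ⟨a, ha⟩ := exists_symMatrix_ne_zero (T.map_ne_zero_iff.mpr (veroneseVec_ne_zero hv))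
  let F (b : Fin (k + 1)) : MvPolynomial (Fin (k + 1)) ℂ :=
    pullbackForm (fun q => monomial (symExp q) 1) (LinearMap.proj s(a, b) ∘ₗ T.toLinearMap)
  have heval (w : Fin (k + 1) → ℂ) :
      (fun b => eval w (F b)) = symMatrix (T (veroneseVec w)) a := funext fun b => by
    simp only [F, eval_pullbackForm, eval_monomial_symExp]
    rfl
  refine ⟨2, F, fun b => pullbackForm_isWeightedHomogeneous (fun q => ?_) _, by rwa [heval],
    fun w hw hF => ?_⟩
  · have hq : (symExp q).degree = 2 := range_symExp.subset ⟨q, rfl⟩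
    exact isHomogeneous_monomial 1 hq
  · simp only [heval] at hF ⊢
    exact eq_mk_symMatrix (by rw [hT, veroneseEmb_mk, projMap_mk]) hF

theorem IsProjEquiv.mem_autP2 {α : Equiv.Perm (CP 2)}
    (h : IsProjEquiv veroneseEmb veroneseEmb α) : α ∈ AutP2 :=
  ⟨h.isRegularMap, h.symm.isRegularMap⟩

theorem IsVeronese.isProjEquiv {X : Set (CP 5)} {φ : CP 2 ≃ X} (h : IsVeronese φ) :
    IsProjEquiv veroneseEmb Subtype.val φ := by
  obtain ⟨F, hF, hspan, hφ⟩ := h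
  have hrange : Set.range (symExp (σ := Fin 3)) = {d | Finsupp.weight 1 d = 2} := by
    rw [range_symExp, Finsupp.degree_eq_weight_one]
    rfl
  obtain ⟨H, hH⟩ := exists_linearEquiv_eval symExp_injective hrange hF hspan
  refine ⟨H, fun x => ?_⟩
  obtain ⟨v, hv, rfl⟩ := exists_mk_eq x
  obtain ⟨_, hφv⟩ := hφ v hv
  rw [hφv, veroneseEmb_mk, projMap_mk]
  simp only [hH, eval_monomial_symExp]

/-! ### Toric structures -/

section Toric

variable {I : Type*}

theorem dense_setOf_forall_ne_zero : Dense {v : I → ℂ | ∀ i, v i ≠ 0} := by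
  have hdense := dense_pi Set.univ fun (_ : I) _ => dense_compl_singleton (0 : ℂ)
  simpa [Set.pi] using hdense

theorem torusPoint_eq_mk [Nonempty I] {f : I → Fin 2 → ℤ} {t : Torus} {v : I → ℂ} (hv : v ≠ 0)
    (c : ℂ) (h : ∀ i, c * v i = character (f i) t) : torusPoint f t = mk ℂ v hv :=
  (mk_eq_mk_iff' ℂ _ _ _ _).mpr ⟨c, funext h⟩

/-- The exponents, centred by the translation by `c`, of the composition with the Veronese
embedding of the monomial map with exponents `f`. -/
def veroneseExp (f : I → Fin 2 → ℤ) (c : Fin 2 → ℤ) (q : Sym2 I) : Fin 2 → ℤ := (q.map f).add + c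

instance [Nonempty I] : Nonempty (Sym2 I) := ‹Nonempty I›.map Sym2.diag

theorem veroneseEmb_torusPoint [Nonempty I] (f : I → Fin 2 → ℤ) (c : Fin 2 → ℤ) (t : Torus) :
    veroneseEmb (torusPoint f t) = torusPoint (veroneseExp f c) t := by
  refine (veroneseEmb_mk _ _).trans (torusPoint_eq_mk _ (character c t) fun q => ?_).symm
  induction q with
  | _ a b =>
    change _ = character (f a + f b + c) t
    rw [character_add, character_add, veroneseVec_mk, mul_comm]
    rfl

/-- The exponents of the chart `(t₀ : t₁ : 1)` of the plane. -/
def planeExp : Fin 3 → Fin 2 → ℤ := ![![1, 0], ![0, 1], 0]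

theorem exists_torusPoint_planeExp_eq {v : Fin 3 → ℂ} (hv : v ≠ 0) (hv' : ∀ i, v i ≠ 0) :
    ∃ t, torusPoint planeExp t = mk ℂ v hv := by
  refine ⟨![Units.mk0 _ (hv' 0) / Units.mk0 _ (hv' 2), Units.mk0 _ (hv' 1) / Units.mk0 _ (hv' 2)],
    torusPoint_eq_mk hv (v 2)⁻¹ fun i => ?_⟩
  fin_cases i <;> simp [character, planeExp, hv', div_eq_inv_mul]

/-- The lattice points of the triangle, indexed by the quadratic monomials. -/
def triangleExp : Sym2 (Fin 3) → Fin 2 → ℤ := veroneseExp planeExp ![-1, -1]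

theorem isToricModel_veroneseEmb :
    IsToricModel veroneseEmb triangleExp (torusPoint planeExp) where
  injective := veroneseEmb_injective
  isAlgebraicSet_range := isAlgebraicSet_range_veroneseEmb
  emb_torus := veroneseEmb_torusPoint planeExp _
  cone_subset_closure := by
    rintro _ ⟨hy, x, hx⟩
    obtain ⟨v, -, -, rfl⟩ := exists_veroneseVec_eq hx
    refine closure_mono ?_ (image_closure_subset_closure_image continuous_veroneseVec
      ⟨v, dense_setOf_forall_ne_zero v, rfl⟩)
    rintro _ ⟨u, hu, rfl⟩
    have hu' : u ≠ 0 := fun h => hu 0 (congrFun h 0)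
    obtain ⟨t, ht⟩ := exists_torusPoint_planeExp_eq hu' hu
    exact ⟨veroneseVec_ne_zero hu', _, ⟨t, ht⟩, veroneseEmb_mk u hu'⟩

theorem mem_range_triangleExp {v : Fin 2 → ℤ} (hv : (fun j => (v j : ℝ)) ∈ trianglePolygon) :
    v ∈ Set.range triangleExp := by
  have hsub : trianglePolygon ⊆ {x | -1 ≤ x 0} ∩ ({x | -1 ≤ x 1} ∩ {x | x 0 + x 1 ≤ 0}) := by
    refine convexHull_min ?_ (Convex.inter ?_ (Convex.inter ?_ ?_))
    · rintro x (rfl | rfl | rfl) <;> norm_num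
    · exact convex_halfSpace_ge (LinearMap.proj (0 : Fin 2)).isLinear _
    · exact convex_halfSpace_ge (LinearMap.proj (1 : Fin 2)).isLinear _
    · exact convex_halfSpace_le
        ⟨fun x y => add_add_add_comm (x 0) (y 0) (x 1) (y 1), fun c x => (mul_add c _ _).symm⟩ _
  obtain ⟨h0, h1, h01⟩ := hsub hv
  simp only [Set.mem_ofPred_eq] at h0 h1 h01
  norm_cast at h0 h1 h01
  have hcases : ∀ x ∈ Finset.Icc (-1 : ℤ) 1, ∀ y ∈ Finset.Icc (-1 : ℤ) 1, x + y ≤ 0 →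
      ∃ q, triangleExp q = ![x, y] := by decide
  obtain ⟨q, hq⟩ := hcases (v 0) (Finset.mem_Icc.mpr ⟨h0, by omega⟩) (v 1)
    (Finset.mem_Icc.mpr ⟨h1, by omega⟩) h01
  exact ⟨q, hq.trans (List.ofFn_injective rfl)⟩

theorem isStandardRealStructure_of_mem_triangleInvolutions {X : Set (CP 5)} {φ : CP 2 ≃ X}
    (hφ : IsProjEquiv veroneseEmb Subtype.val φ) {σ : X → X} (hσ : σ ∈ triangleInvolutions X) :
    IsStandardRealStructure veroneseEmb (conjP 2) σ := by
  obtain ⟨⟨-, hanti⟩, hact⟩ := hσ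
  have key {M : Matrix (Fin 2) (Fin 2) ℤ} (s : Equiv.Perm (Fin 3)) (hs : Function.Involutive s)
      (hM : ActsAs σ trianglePolygon M)
      (hsM : ∀ q, triangleExp (symPerm s q) = M.mulVec (triangleExp q)) :
      IsStandardRealStructure veroneseEmb (conjP 2) σ :=
    isToricModel_veroneseEmb.isStandardRealStructure (by decide) (by rw [Sym2.card]; rfl)
      (fun _ => mem_range_triangleExp) hφ hanti hM hsM
      (isProjEquiv_veroneseEmb_projPerm (straighten s hs)) fun z => by
        rw [projConjPerm_veroneseEmb, projConjPerm_projPerm_straighten, conjP_eq_projConjPerm]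
  rcases hact with hM | hM
  · exact key 1 (fun _ => rfl) hM (by decide)
  · exact key (Equiv.swap 0 1) (Equiv.swap_apply_self 0 1) hM (by decide)

end Toric

/-! ### The Segre embedding -/

section Segre

variable {I J I' J' Z Z' W W' : Type*}

/-- The vector of the products `v i * w j`, indexed by pairs. -/
def segreVec (v : I → ℂ) (w : J → ℂ) : I × J → ℂ := fun p => v p.1 * w p.2

theorem segreVec_ne_zero {v : I → ℂ} {w : J → ℂ} (hv : v ≠ 0) (hw : w ≠ 0) :
    segreVec v w ≠ 0 := by
  obtain ⟨i, hi⟩ := Function.ne_iff.mp hv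
  obtain ⟨j, hj⟩ := Function.ne_iff.mp hw
  exact Function.ne_iff.mpr ⟨(i, j), mul_ne_zero hi hj⟩

theorem segreVec_smul_smul (a b : ℂ) (v : I → ℂ) (w : J → ℂ) :
    segreVec (a • v) (b • w) = (a * b) • segreVec v w :=
  funext fun p => mul_mul_mul_comm a (v p.1) b (w p.2)

/-- The Segre embedding of a product of projective spaces. -/
def segreEmb (x : CoordP I × CoordP J) : CoordP (I × J) :=
  mk ℂ (segreVec x.1.rep x.2.rep) (segreVec_ne_zero x.1.rep_nonzero x.2.rep_nonzero)

theorem segreEmb_mk (v : I → ℂ) (hv : v ≠ 0) (w : J → ℂ) (hw : w ≠ 0) :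
    segreEmb (mk ℂ v hv, mk ℂ w hw) = mk ℂ (segreVec v w) (segreVec_ne_zero hv hw) := by
  obtain ⟨a, ha⟩ := exists_smul_eq_mk_rep ℂ v hv
  obtain ⟨b, hb⟩ := exists_smul_eq_mk_rep ℂ w hw
  rw [segreEmb, mk_eq_mk_iff']
  exact ⟨(a * b : ℂ), by rw [← segreVec_smul_smul, ← ha, ← hb]; rfl⟩

theorem exists_prod_mk_eq (x : CoordP I × CoordP J) :
    ∃ (v : I → ℂ) (hv : v ≠ 0) (w : J → ℂ) (hw : w ≠ 0), (mk ℂ v hv, mk ℂ w hw) = x :=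
  ⟨_, x.1.rep_nonzero, _, x.2.rep_nonzero, Prod.ext x.1.mk_rep x.2.mk_rep⟩

theorem exists_segreVec_eq {y : I × J → ℂ} {hy : y ≠ 0} {x : CoordP I × CoordP J}
    (hx : segreEmb x = mk ℂ y hy) : ∃ (v : I → ℂ) (hv : v ≠ 0) (w : J → ℂ) (hw : w ≠ 0),
      (mk ℂ v hv, mk ℂ w hw) = x ∧ segreVec v w = y := by
  obtain ⟨v, hv, w, hw, rfl⟩ := exists_prod_mk_eq x
  rw [segreEmb_mk, eq_comm, mk_eq_mk_iff'] at hx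
  obtain ⟨a, rfl⟩ := hx
  have ha : a ≠ 0 := by
    rintro rfl
    exact hy (zero_smul ℂ _)
  refine ⟨a • v, smul_ne_zero ha hv, w, hw, ?_, ?_⟩
  · exact congrArg (·, mk ℂ w hw) ((mk_eq_mk_iff' ℂ _ _ _ _).mpr ⟨a, rfl⟩)
  · simpa using segreVec_smul_smul a 1 v w

theorem fst_eq_mk_of_segreEmb_eq {x : CoordP I × CoordP J} {y : I × J → ℂ} {hy : y ≠ 0}
    (h : segreEmb x = mk ℂ y hy) {j : J} (hj : (fun i => y (i, j)) ≠ 0) :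
    x.1 = mk ℂ (fun i => y (i, j)) hj := by
  obtain ⟨v, hv, w, hw, rfl, rfl⟩ := exists_segreVec_eq h
  refine mk_eq_mk_of_mul_eq_mul hv hj fun i i' => ?_
  simp only [segreVec]
  ring

theorem snd_eq_mk_of_segreEmb_eq {x : CoordP I × CoordP J} {y : I × J → ℂ} {hy : y ≠ 0}
    (h : segreEmb x = mk ℂ y hy) {i : I} (hi : (fun j => y (i, j)) ≠ 0) :
    x.2 = mk ℂ (fun j => y (i, j)) hi := by
  obtain ⟨v, hv, w, hw, rfl, rfl⟩ := exists_segreVec_eq h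
  refine mk_eq_mk_of_mul_eq_mul hw hi fun j j' => ?_
  simp only [segreVec]
  ring

theorem segreEmb_injective : Function.Injective (segreEmb (I := I) (J := J)) := by
  intro x x' h
  obtain ⟨y, hy, hyx⟩ := exists_mk_eq (segreEmb x')
  obtain ⟨⟨i, j⟩, hij⟩ := Function.ne_iff.mp hy
  have hj : (fun i => y (i, j)) ≠ 0 := Function.ne_iff.mpr ⟨i, hij⟩
  have hi : (fun j => y (i, j)) ≠ 0 := Function.ne_iff.mpr ⟨j, hij⟩
  exact Prod.ext
    ((fst_eq_mk_of_segreEmb_eq (h.trans hyx.symm) hj).trans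
      (fst_eq_mk_of_segreEmb_eq hyx.symm hj).symm)
    ((snd_eq_mk_of_segreEmb_eq (h.trans hyx.symm) hi).trans
      (snd_eq_mk_of_segreEmb_eq hyx.symm hi).symm)

theorem segreEmb_mk_mk_eq {y : I × J → ℂ} (hy : y ≠ 0)
    (h : ∀ i i' j j', y (i, j) * y (i', j') = y (i, j') * y (i', j)) {i₀ : I} {j₀ : J}
    (hi : (fun j => y (i₀, j)) ≠ 0) (hj : (fun i => y (i, j₀)) ≠ 0) :
    segreEmb (mk ℂ _ hj, mk ℂ _ hi) = mk ℂ y hy := by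
  rw [segreEmb_mk, mk_eq_mk_iff']
  exact ⟨y (i₀, j₀), funext fun ⟨i, j⟩ => (mul_comm _ _).trans (h i i₀ j j₀)⟩

theorem projConjPerm_segreEmb (π : Equiv.Perm I) (ρ : Equiv.Perm J)
    (x : CoordP I × CoordP J) : projConjPerm (π.prodCongr ρ) (segreEmb x) =
      segreEmb (x.map (projConjPerm π) (projConjPerm ρ)) := by
  obtain ⟨v, hv, w, hw, rfl⟩ := exists_prod_mk_eq x
  have hvec : conjPerm (π.prodCongr ρ) (segreVec v w) =
      segreVec (conjPerm π v) (conjPerm ρ w) :=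
    funext fun p => map_mul (starRingEnd ℂ) (v (π p.1)) (w (ρ p.2))
  simp only [segreEmb_mk, projConjPerm_mk, Prod.map, hvec]

theorem funCongrLeft_prodComm_segreVec (v : I → ℂ) (w : J → ℂ) :
    LinearEquiv.funCongrLeft ℂ ℂ (Equiv.prodComm J I) (segreVec v w) = segreVec w v :=
  funext fun p => mul_comm (v p.2) (w p.1)

theorem exists_linearEquiv_segreVec_right (I : Type*) (S : (J → ℂ) ≃ₗ[ℂ] (J' → ℂ)) :
    ∃ R : (I × J → ℂ) ≃ₗ[ℂ] (I × J' → ℂ), ∀ v w, R (segreVec v w) = segreVec v (S w) :=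
  ⟨(LinearEquiv.curry ℂ ℂ I J).trans ((LinearEquiv.piCongrRight fun _ => S).trans
    (LinearEquiv.curry ℂ ℂ I J').symm), fun v w => funext fun p =>
      congrFun (map_smul S (v p.1) w) p.2⟩

theorem exists_linearEquiv_segreVec (T : (I → ℂ) ≃ₗ[ℂ] (I' → ℂ))
    (S : (J → ℂ) ≃ₗ[ℂ] (J' → ℂ)) : ∃ R : (I × J → ℂ) ≃ₗ[ℂ] (I' × J' → ℂ),
      ∀ v w, R (segreVec v w) = segreVec (T v) (S w) := by
  obtain ⟨R, hR⟩ := exists_linearEquiv_segreVec_right I S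
  obtain ⟨R', hR'⟩ := exists_linearEquiv_segreVec_right J' T
  refine ⟨R.trans ((LinearEquiv.funCongrLeft ℂ ℂ (Equiv.prodComm J' I)).trans
    (R'.trans (LinearEquiv.funCongrLeft ℂ ℂ (Equiv.prodComm I' J')))), fun v w => ?_⟩
  simp only [LinearEquiv.trans_apply, hR, hR', funCongrLeft_prodComm_segreVec]

theorem IsProjEquiv.prod {emb : Z → CoordP I} {emb' : Z' → CoordP I'} {α : Z ≃ Z'}
    {fmb : W → CoordP J} {fmb' : W' → CoordP J'} {β : W ≃ W'}
    (hα : IsProjEquiv emb emb' α) (hβ : IsProjEquiv fmb fmb' β) :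
    IsProjEquiv (segreEmb ∘ Prod.map emb fmb) (segreEmb ∘ Prod.map emb' fmb')
      (α.prodCongr β) := by
  obtain ⟨T, hT⟩ := hα
  obtain ⟨S, hS⟩ := hβ
  obtain ⟨R, hR⟩ := exists_linearEquiv_segreVec T S
  refine ⟨R, fun z => ?_⟩
  obtain ⟨v, hv, hvz⟩ := exists_mk_eq (emb z.1)
  obtain ⟨w, hw, hwz⟩ := exists_mk_eq (fmb z.2)
  simp only [Function.comp_apply, Prod.map, Equiv.prodCongr_apply, hT, hS, ← hvz, ← hwz,
    projMap_mk, segreEmb_mk, hR]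

end Segre

/-! ### The double Segre embedding -/

section DoubleSegre

variable {σ τ : Type*}

/-- The embedding of a product of projective spaces by the forms of bidegree `(2, 2)`. -/
def doubleSegreEmb : CoordP σ × CoordP τ → CoordP (Sym2 σ × Sym2 τ) :=
  segreEmb ∘ Prod.map veroneseEmb veroneseEmb

theorem doubleSegreEmb_mk (v : σ → ℂ) (hv : v ≠ 0) (w : τ → ℂ) (hw : w ≠ 0) :
    doubleSegreEmb (mk ℂ v hv, mk ℂ w hw) =
      mk ℂ (segreVec (veroneseVec v) (veroneseVec w))
        (segreVec_ne_zero (veroneseVec_ne_zero hv) (veroneseVec_ne_zero hw)) := by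
  simp only [doubleSegreEmb, Function.comp_apply, Prod.map, veroneseEmb_mk, segreEmb_mk]

theorem doubleSegreEmb_injective : Function.Injective (doubleSegreEmb (σ := σ) (τ := τ)) :=
  segreEmb_injective.comp (veroneseEmb_injective.prodMap veroneseEmb_injective)

theorem exists_doubleSegreVec_eq {y : Sym2 σ × Sym2 τ → ℂ} {hy : y ≠ 0}
    {x : CoordP σ × CoordP τ} (hx : doubleSegreEmb x = mk ℂ y hy) :
    ∃ (v : σ → ℂ) (w : τ → ℂ), segreVec (veroneseVec v) (veroneseVec w) = y := by
  obtain ⟨u, hu, u', hu', huu', rfl⟩ := exists_segreVec_eq hx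
  obtain ⟨v, -, -, rfl⟩ := exists_veroneseVec_eq (congrArg Prod.fst huu').symm
  obtain ⟨w, -, -, rfl⟩ := exists_veroneseVec_eq (congrArg Prod.snd huu').symm
  exact ⟨v, w, rfl⟩

theorem mul_eq_mul_of_doubleSegre_relations {y : Sym2 σ × Sym2 τ → ℂ} (h : ∀ k : Fin 4 → σ × τ,
      y (s((k 0).1, (k 1).1), s((k 0).2, (k 1).2)) * y (s((k 2).1, (k 3).1), s((k 2).2, (k 3).2)) =
        y (s((k 0).1, (k 2).1), s((k 0).2, (k 2).2)) *
          y (s((k 1).1, (k 3).1), s((k 1).2, (k 3).2))) (q q' : Sym2 σ) (r r' : Sym2 τ) :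
    y (q, r) * y (q', r') = y (q, r') * y (q', r) := by
  induction q with | _ a b
  induction q' with | _ a' b'
  induction r with | _ c d
  induction r' with | _ c' d'
  have h1 : y (s(a, b), s(c, d)) * y (s(a', b'), s(c', d')) =
      y (s(a, a'), s(c, c')) * y (s(b, b'), s(d, d')) :=
    h ![(a, c), (b, d), (a', c'), (b', d')]
  have h2 : y (s(a, b), s(c', d')) * y (s(a', b'), s(c, d)) =
      y (s(a, a'), s(c', c)) * y (s(b, b'), s(d', d)) :=
    h ![(a, c'), (b, d'), (a', c), (b', d)]
  rw [h1, h2, Sym2.eq_swap (a := c), Sym2.eq_swap (a := d)]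

theorem mk_mem_range_doubleSegreEmb_iff (y : Sym2 σ × Sym2 τ → ℂ) (hy : y ≠ 0) :
    mk ℂ y hy ∈ Set.range doubleSegreEmb ↔ ∀ k : Fin 4 → σ × τ,
      y (s((k 0).1, (k 1).1), s((k 0).2, (k 1).2)) * y (s((k 2).1, (k 3).1), s((k 2).2, (k 3).2)) =
        y (s((k 0).1, (k 2).1), s((k 0).2, (k 2).2)) *
          y (s((k 1).1, (k 3).1), s((k 1).2, (k 3).2)) := by
  constructor
  · rintro ⟨x, hx⟩ k
    obtain ⟨v, w, rfl⟩ := exists_doubleSegreVec_eq hx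
    simp only [segreVec, veroneseVec_mk]
    ring
  · intro h
    obtain ⟨⟨q, r⟩, hqr⟩ := Function.ne_iff.mp hy
    have hq : (fun r => y (q, r)) ≠ 0 := Function.ne_iff.mpr ⟨r, hqr⟩
    have hr : (fun q => y (q, r)) ≠ 0 := Function.ne_iff.mpr ⟨q, hqr⟩
    obtain ⟨x, hx⟩ := (mk_mem_range_veroneseEmb_iff _ hr).mpr fun k => by
      induction r with | _ c d
      simpa [Sym2.eq_swap (a := d)] using h ![(k 0, c), (k 1, d), (k 2, d), (k 3, c)]
    obtain ⟨z, hz⟩ := (mk_mem_range_veroneseEmb_iff _ hq).mpr fun k => by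
      induction q with | _ a b
      simpa [Sym2.eq_swap (a := b)] using h ![(a, k 0), (b, k 1), (b, k 2), (a, k 3)]
    refine ⟨(x, z), ?_⟩
    rw [← segreEmb_mk_mk_eq hy (mul_eq_mul_of_doubleSegre_relations h) hq hr, ← hx, ← hz]
    rfl

theorem isAlgebraicSet_range_doubleSegreEmb :
    IsAlgebraicSet (Set.range (doubleSegreEmb (σ := σ) (τ := τ))) :=
  isAlgebraicSet_of_mul_eq_mul
    (fun k : Fin 4 → σ × τ => (s((k 0).1, (k 1).1), s((k 0).2, (k 1).2)))
    (fun k => (s((k 2).1, (k 3).1), s((k 2).2, (k 3).2)))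
    (fun k => (s((k 0).1, (k 2).1), s((k 0).2, (k 2).2)))
    (fun k => (s((k 1).1, (k 3).1), s((k 1).2, (k 3).2))) mk_mem_range_doubleSegreEmb_iff

theorem projConjPerm_doubleSegreEmb (s : Equiv.Perm σ) (s' : Equiv.Perm τ)
    (x : CoordP σ × CoordP τ) :
    projConjPerm ((symPerm s).prodCongr (symPerm s')) (doubleSegreEmb x) =
      doubleSegreEmb (x.map (projConjPerm s) (projConjPerm s')) := by
  simp only [doubleSegreEmb, Function.comp_apply, projConjPerm_segreEmb, Prod.map,
    projConjPerm_veroneseEmb]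

theorem fst_eq_mk_of_doubleSegreEmb_eq {x : CoordP σ × CoordP τ} {y : Sym2 σ × Sym2 τ → ℂ}
    {hy : y ≠ 0} (h : doubleSegreEmb x = mk ℂ y hy) {a : σ} {r : Sym2 τ}
    (ha : (fun b => y (s(a, b), r)) ≠ 0) : x.1 = mk ℂ (fun b => y (s(a, b), r)) ha := by
  have hr : (fun q => y (q, r)) ≠ 0 := fun h => ha (funext fun b => congrFun h s(a, b))
  exact eq_mk_symMatrix (fst_eq_mk_of_segreEmb_eq h hr) ha

theorem snd_eq_mk_of_doubleSegreEmb_eq {x : CoordP σ × CoordP τ} {y : Sym2 σ × Sym2 τ → ℂ}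
    {hy : y ≠ 0} (h : doubleSegreEmb x = mk ℂ y hy) {q : Sym2 σ} {c : τ}
    (hc : (fun d => y (q, s(c, d))) ≠ 0) : x.2 = mk ℂ (fun d => y (q, s(c, d))) hc := by
  have hq : (fun r => y (q, r)) ≠ 0 := fun h => hc (funext fun d => congrFun h s(c, d))
  exact eq_mk_symMatrix (snd_eq_mk_of_segreEmb_eq h hq) hc

/-- The exponent of the monomial of bidegree `(2, 2)` given by a pair of unordered pairs. -/
def symProdExp [DecidableEq σ] [DecidableEq τ] (p : Sym2 σ × Sym2 τ) : σ ⊕ τ →₀ ℕ :=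
  (symExp p.1).sumElim (symExp p.2)

theorem symProdExp_injective [DecidableEq σ] [DecidableEq τ] :
    Function.Injective (symProdExp (σ := σ) (τ := τ)) :=
  Finsupp.sumFinsuppEquivProdFinsupp.symm.injective.comp
    (symExp_injective.prodMap symExp_injective)

theorem eval_monomial_symProdExp [DecidableEq σ] [DecidableEq τ] (v : σ → ℂ) (w : τ → ℂ)
    (p : Sym2 σ × Sym2 τ) : eval (Sum.elim v w) (monomial (symProdExp p) 1) =
      segreVec (veroneseVec v) (veroneseVec w) p := by
  rw [segreVec, ← eval_monomial_symExp, ← eval_monomial_symExp]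
  simp only [symProdExp, eval_monomial, one_mul, Finsupp.prod_sumElim]
  rfl

end DoubleSegre

/-! ### Double Segre surfaces -/

theorem weight_biWeight_sumElim (d d' : Fin 2 →₀ ℕ) :
    Finsupp.weight biWeight (d.sumElim d') = (d.degree, d'.degree) := by
  rw [Finsupp.weight_apply, Finsupp.sum_fintype _ _ (by simp), Fintype.sum_sum_type,
    Finsupp.degree_eq_sum, Finsupp.degree_eq_sum]
  simp [biWeight]

theorem range_symProdExp : Set.range (symProdExp (σ := Fin 2) (τ := Fin 2)) =
    {d | Finsupp.weight biWeight d = (2, 2)} := by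
  ext d
  obtain ⟨⟨d₁, d₂⟩, rfl⟩ := Finsupp.sumFinsuppEquivProdFinsupp.symm.surjective d
  have hsymExp (d : Fin 2 →₀ ℕ) : d.degree = 2 ↔ ∃ q, symExp q = d :=
    (Set.ext_iff.mp range_symExp d).symm
  rw [Set.mem_ofPred_eq, Finsupp.sumFinsuppEquivProdFinsupp_symm_apply, weight_biWeight_sumElim,
    Prod.mk.injEq, hsymExp, hsymExp]
  constructor
  · rintro ⟨⟨q, r⟩, h⟩
    obtain ⟨rfl, rfl⟩ := Prod.mk.inj (Finsupp.sumFinsuppEquivProdFinsupp.symm.injective h)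
    exact ⟨⟨q, rfl⟩, r, rfl⟩
  · rintro ⟨⟨q, rfl⟩, r, rfl⟩
    exact ⟨(q, r), rfl⟩

theorem isBiregularlyDefined_of_linearMap {ι : Type*} {m : ℕ} {f : CP 1 × CP 1 → CP m}
    (L : ι → (Sym2 (Fin 2) × Sym2 (Fin 2) → ℂ) →ₗ[ℂ] (Fin (m + 1) → ℂ))
    (hL : ∀ y ≠ 0, ∃ k, L k y ≠ 0)
    (hf : ∀ (k : ι) (v w : Fin 2 → ℂ) (hv : v ≠ 0) (hw : w ≠ 0)
      (h : L k (segreVec (veroneseVec v) (veroneseVec w)) ≠ 0),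
        f (mk ℂ v hv, mk ℂ w hw) = mk ℂ _ h) : IsBiregularlyDefined f := by
  intro v w hv hw
  obtain ⟨k, hk⟩ := hL _ (segreVec_ne_zero (veroneseVec_ne_zero hv) (veroneseVec_ne_zero hw))
  let F (i : Fin (m + 1)) : MvPolynomial (Fin 2 ⊕ Fin 2) ℂ :=
    pullbackForm (fun p => monomial (symProdExp p) 1) (LinearMap.proj i ∘ₗ L k)
  have heval (v w : Fin 2 → ℂ) : (fun i => eval (Sum.elim v w) (F i)) =
      L k (segreVec (veroneseVec v) (veroneseVec w)) := funext fun i => by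
    simp only [F, eval_pullbackForm, eval_monomial_symProdExp]
    rfl
  refine ⟨(2, 2), F, fun i => pullbackForm_isWeightedHomogeneous (fun p => ?_) _, by rwa [heval],
    fun v' w' hv' hw' hF => ?_⟩
  · exact isWeightedHomogeneous_monomial _ _ 1 (range_symProdExp.subset ⟨p, rfl⟩)
  · simp only [heval] at hF ⊢
    exact hf k v' w' hv' hw' hF

theorem IsProjEquiv.isRegularSelfMap {α : Equiv.Perm (CP 1 × CP 1)}
    (h : IsProjEquiv doubleSegreEmb doubleSegreEmb α) : IsRegularSelfMap α := by
  obtain ⟨T, hT⟩ := h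
  have hα {v w : Fin 2 → ℂ} (hv : v ≠ 0) (hw : w ≠ 0) :
      ∃ hy, doubleSegreEmb (α (mk ℂ v hv, mk ℂ w hw)) =
        mk ℂ (T (segreVec (veroneseVec v) (veroneseVec w))) hy :=
    ⟨_, by rw [hT, doubleSegreEmb_mk, projMap_mk]⟩
  constructor
  · refine isBiregularlyDefined_of_linearMap
      (fun k : Fin 2 × Sym2 (Fin 2) =>
        LinearMap.funLeft ℂ ℂ (fun b => (s(k.1, b), k.2)) ∘ₗ T.toLinearMap)
      (fun y hy => ?_) fun _ _ _ hv hw hk => fst_eq_mk_of_doubleSegreEmb_eq (hα hv hw).2 hk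
    obtain ⟨⟨q, r⟩, hqr⟩ := Function.ne_iff.mp (T.map_ne_zero_iff.mpr hy)
    induction q with | _ a b => exact ⟨(a, r), Function.ne_iff.mpr ⟨b, hqr⟩⟩
  · refine isBiregularlyDefined_of_linearMap
      (fun k : Sym2 (Fin 2) × Fin 2 =>
        LinearMap.funLeft ℂ ℂ (fun d => (k.1, s(k.2, d))) ∘ₗ T.toLinearMap)
      (fun y hy => ?_) fun _ _ _ hv hw hk => snd_eq_mk_of_doubleSegreEmb_eq (hα hv hw).2 hk
    obtain ⟨⟨q, r⟩, hqr⟩ := Function.ne_iff.mp (T.map_ne_zero_iff.mpr hy)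
    induction r with | _ c d => exact ⟨(q, c), Function.ne_iff.mpr ⟨d, hqr⟩⟩

theorem IsProjEquiv.mem_autP1P1 {α : Equiv.Perm (CP 1 × CP 1)}
    (h : IsProjEquiv doubleSegreEmb doubleSegreEmb α) : α ∈ AutP1P1 :=
  ⟨h.isRegularSelfMap, h.symm.isRegularSelfMap⟩

theorem IsDoubleSegre.isProjEquiv {X : Set (CP 8)} {φ : CP 1 × CP 1 ≃ X} (h : IsDoubleSegre φ) :
    IsProjEquiv doubleSegreEmb Subtype.val φ := by
  obtain ⟨F, hF, hspan, hφ⟩ := h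
  obtain ⟨H, hH⟩ := exists_linearEquiv_eval symProdExp_injective range_symProdExp hF hspan
  refine ⟨H, fun x => ?_⟩
  obtain ⟨v, hv, w, hw, rfl⟩ := exists_prod_mk_eq x
  obtain ⟨_, hφvw⟩ := hφ v w hv hw
  rw [hφvw, doubleSegreEmb_mk, projMap_mk]
  simp only [hH, eval_monomial_symProdExp]

theorem segreEmb_torusPoint {I J : Type*} [Nonempty I] [Nonempty J] (f : I → Fin 2 → ℤ)
    (g : J → Fin 2 → ℤ) (t : Torus) : segreEmb (torusPoint f t, torusPoint g t) =
      torusPoint (fun p : I × J => f p.1 + g p.2) t := by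
  refine (segreEmb_mk _ _ _ _).trans (torusPoint_eq_mk _ 1 fun p => ?_).symm
  rw [one_mul, character_add]
  rfl

/-- The exponents of the affine chart `(t j : 1)` of the line. -/
def lineExp (j : Fin 2) : Fin 2 → Fin 2 → ℤ := ![Pi.single j 1, 0]

theorem exists_torusPoint_lineExp_eq {v w : Fin 2 → ℂ} (hv : v ≠ 0) (hw : w ≠ 0)
    (hv' : ∀ i, v i ≠ 0) (hw' : ∀ i, w i ≠ 0) : ∃ t,
      torusPoint (lineExp 0) t = mk ℂ v hv ∧ torusPoint (lineExp 1) t = mk ℂ w hw := by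
  refine ⟨![Units.mk0 _ (hv' 0) / Units.mk0 _ (hv' 1), Units.mk0 _ (hw' 0) / Units.mk0 _ (hw' 1)],
    torusPoint_eq_mk hv (v 1)⁻¹ fun i => ?_, torusPoint_eq_mk hw (w 1)⁻¹ fun i => ?_⟩
  all_goals fin_cases i <;> simp [character, lineExp, hv', hw', div_eq_inv_mul]

/-- The lattice points of the square, indexed by the monomials of bidegree `(2, 2)`. -/
def squareExp (p : Sym2 (Fin 2) × Sym2 (Fin 2)) : Fin 2 → ℤ :=
  veroneseExp (lineExp 0) ![-1, 0] p.1 + veroneseExp (lineExp 1) ![0, -1] p.2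

theorem doubleSegreEmb_torusPoint (t : Torus) :
    doubleSegreEmb (torusPoint (lineExp 0) t, torusPoint (lineExp 1) t) =
      torusPoint squareExp t := by
  simp only [doubleSegreEmb, Function.comp_apply, Prod.map]
  rw [veroneseEmb_torusPoint _ ![-1, 0], veroneseEmb_torusPoint _ ![0, -1], segreEmb_torusPoint]
  rfl

theorem isToricModel_doubleSegreEmb : IsToricModel doubleSegreEmb squareExp
    fun t => (torusPoint (lineExp 0) t, torusPoint (lineExp 1) t) where
  injective := doubleSegreEmb_injective
  isAlgebraicSet_range := isAlgebraicSet_range_doubleSegreEmb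
  emb_torus := doubleSegreEmb_torusPoint
  cone_subset_closure := by
    rintro _ ⟨hy, x, hx⟩
    obtain ⟨v, w, rfl⟩ := exists_doubleSegreVec_eq hx
    have hcont : Continuous fun u : (Fin 2 → ℂ) × (Fin 2 → ℂ) =>
        segreVec (veroneseVec u.1) (veroneseVec u.2) := continuous_pi fun p =>
      ((continuous_apply p.1).comp (continuous_veroneseVec.comp continuous_fst)).mul
        ((continuous_apply p.2).comp (continuous_veroneseVec.comp continuous_snd))
    refine closure_mono ?_ (image_closure_subset_closure_image hcont
      ⟨(v, w), dense_setOf_forall_ne_zero.prod dense_setOf_forall_ne_zero (v, w), rfl⟩)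
    rintro _ ⟨⟨v, w⟩, ⟨hv, hw⟩, rfl⟩
    have hv' : v ≠ 0 := fun h => hv 0 (congrFun h 0)
    have hw' : w ≠ 0 := fun h => hw 0 (congrFun h 0)
    obtain ⟨t, htv, htw⟩ := exists_torusPoint_lineExp_eq hv' hw' hv hw
    exact ⟨segreVec_ne_zero (veroneseVec_ne_zero hv') (veroneseVec_ne_zero hw'), _,
      ⟨t, Prod.ext htv htw⟩, doubleSegreEmb_mk v hv' w hw'⟩

theorem mem_range_squareExp {v : Fin 2 → ℤ} (hv : (fun j => (v j : ℝ)) ∈ squarePolygon) :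
    v ∈ Set.range squareExp := by
  have hsub : squarePolygon ⊆ Set.Icc (-1) 1 := by
    refine convexHull_min ?_ (convex_Icc _ _)
    rintro x (rfl | rfl | rfl | rfl) <;> simp [Set.mem_Icc, Pi.le_def, Fin.forall_fin_two]
  obtain ⟨hl, hu⟩ := hsub hv
  have hmem (j) : v j ∈ Finset.Icc (-1 : ℤ) 1 :=
    Finset.mem_Icc.mpr ⟨Int.cast_le.mp (by simpa using hl j), Int.cast_le.mp (by simpa using hu j)⟩
  have hcases : ∀ x ∈ Finset.Icc (-1 : ℤ) 1, ∀ y ∈ Finset.Icc (-1 : ℤ) 1,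
      ∃ p, squareExp p = ![x, y] := by decide
  obtain ⟨p, hp⟩ := hcases (v 0) (hmem 0) (v 1) (hmem 1)
  exact ⟨p, hp.trans (List.ofFn_injective rfl)⟩

theorem isStandardRealStructure_of_mem_squareInvolutions {X : Set (CP 8)} {φ : CP 1 × CP 1 ≃ X}
    (hφ : IsProjEquiv doubleSegreEmb Subtype.val φ) {σ : X → X} (hσ : σ ∈ squareInvolutions X) :
    IsStandardRealStructure doubleSegreEmb (Prod.map (conjP 1) (conjP 1)) σ := by
  obtain ⟨⟨-, hanti⟩, hact⟩ := hσ
  have key {M : Matrix (Fin 2) (Fin 2) ℤ} (s s' : Equiv.Perm (Fin 2)) (hs : Function.Involutive s)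
      (hs' : Function.Involutive s') (hM : ActsAs σ squarePolygon M)
      (hsM : ∀ p, squareExp ((symPerm s).prodCongr (symPerm s') p) = M.mulVec (squareExp p)) :
      IsStandardRealStructure doubleSegreEmb (Prod.map (conjP 1) (conjP 1)) σ :=
    isToricModel_doubleSegreEmb.isStandardRealStructure (by decide)
      (by rw [Fintype.card_prod, Sym2.card]; rfl) (fun _ => mem_range_squareExp) hφ hanti hM hsM
      ((isProjEquiv_veroneseEmb_projPerm (straighten s hs)).prod
        (isProjEquiv_veroneseEmb_projPerm (straighten s' hs'))) fun z => by
        simp only [projConjPerm_doubleSegreEmb, Equiv.prodCongr_apply, Prod.map,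
          projConjPerm_projPerm_straighten, conjP_eq_projConjPerm]
  have hone : Function.Involutive (1 : Equiv.Perm (Fin 2)) := fun _ => rfl
  have hswap := Equiv.swap_apply_self (0 : Fin 2) 1
  rcases hact with hM | hM | hM
  · exact key 1 1 hone hone hM (by decide)
  · exact key (Equiv.swap 0 1) 1 hswap hone hM (by decide)
  · exact key (Equiv.swap 0 1) (Equiv.swap 0 1) hswap hswap hM (by decide)

end RealToric

end

theorem corollary4 :
    (∀ (X : Set (RealToric.CP 8)) (φ : RealToric.CP 1 × RealToric.CP 1 ≃ X),
      RealToric.IsDoubleSegre φ →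
        (∀ σ ∈ RealToric.squareInvolutions X, ∀ σ' ∈ RealToric.squareInvolutions X,
          RealToric.InnerAutomorphicVia φ RealToric.AutP1P1 σ σ') ∧
        (∀ σ ∈ RealToric.squareInvolutions X,
          RealToric.InnerAutomorphicVia φ RealToric.AutP1P1 σ
            (φ ∘ Prod.map (RealToric.conjP 1) (RealToric.conjP 1) ∘ φ.symm))) ∧
    (∀ (X : Set (RealToric.CP 5)) (φ : RealToric.CP 2 ≃ X),
      RealToric.IsVeronese φ →
        (∀ σ ∈ RealToric.triangleInvolutions X, ∀ σ' ∈ RealToric.triangleInvolutions X,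
          RealToric.InnerAutomorphicVia φ RealToric.AutP2 σ σ') ∧
        (∀ σ ∈ RealToric.triangleInvolutions X,
          RealToric.InnerAutomorphicVia φ RealToric.AutP2 σ
            (φ ∘ RealToric.conjP 2 ∘ φ.symm))) := by
  constructor
  · intro X φ hX
    have hφ := hX.isProjEquiv
    have hstd σ (hσ : σ ∈ RealToric.squareInvolutions X) :=
      RealToric.isStandardRealStructure_of_mem_squareInvolutions hφ hσ
    have hAut (α) (hα : RealToric.IsProjEquiv _ _ α) := hα.mem_autP1P1
    exact ⟨fun σ hσ σ' hσ' => (hstd σ hσ).innerAutomorphicVia (hstd σ' hσ') hφ hAut,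
      fun σ hσ => (hstd σ hσ).innerAutomorphicVia (hφ.isStandardRealStructure_conj _) hφ hAut⟩
  · intro X φ hX
    have hφ := hX.isProjEquiv
    have hstd σ (hσ : σ ∈ RealToric.triangleInvolutions X) :=
      RealToric.isStandardRealStructure_of_mem_triangleInvolutions hφ hσ
    have hAut (α) (hα : RealToric.IsProjEquiv _ _ α) := hα.mem_autP2
    exact ⟨fun σ hσ σ' hσ' => (hstd σ hσ).innerAutomorphicVia (hstd σ' hσ') hφ hAut,
      fun σ hσ => (hstd σ hσ).innerAutomorphicVia (hφ.isStandardRealStructure_conj _) hφ hAut⟩
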